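/- Let $F$ be a finite tree with bipartition $V(F)=A\cup B$ into partite sets with $|A|\le |B|$, put $q=|A|-1$ and assume $q\ge 1$. Let $\delta=\min\{d_F(x):x\in A\}$, and let $\beta(F)$ be the minimum size of a vertex cover of $F$. For a graph $G$ let $\rho(G)$ be the largest eigenvalue of its adjacency matrix, and let $\mathrm{SPEX}(n,F)$ be the set of graphs of order $n$ that contain no subgraph isomorphic to $F$ and that have maximum $\rho$ among all such graphs of order $n$. Let $\mathcal A=\{K_{q+1}\}$ if $\beta(F)=q+1$, and otherwise $$\mathcal A=\{F[S] : S \text{ is a vertex cover of } F \text{ with } |S|\le q\}.$$ Let $\mathrm{EX}(q,\mathcal A)$ be the set of graphs of order $q$ that contain no subgraph isomorphic to a member of $\mathcal A$ and that have the maximum number of edges among all such graphs of order $q$. Write $G\nabla H$ for the join of $G$ and $H$, and $S^0_{n,q}=K_q\nabla (n-q)K_1$. Graphs are considered up to isomorphism. Then there is an integer $N$ (depending on $F$) such that for every $n\ge N$ the following hold: - $\mathrm{SPEX}(n,F)\subseteq\{Q\nabla (n-q)K_1 : Q\in \mathrm{EX}(q,\mathcal A)\}$ if and only if $\delta=1$;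 - (i) $\mathrm{SPEX}(n,F)=\{K_{q,n-q}\}$ if and only if $\delta=1$ and $\mathrm{EX}(q,\mathcal A)=\{qK_1\}$; - (ii) $\mathrm{SPEX}(n,F)=\{S^0_{n,q}\}$ if and only if $\delta=1$ and $\beta(F)=q+1$. -/

import Mathlib

namespace SpectralTree

open SimpleGraph

/-- The join `G ∇ H`: the disjoint union of `G` and `H` together with all edges between them. -/
def join {V W : Type*} (G : SimpleGraph V) (H : SimpleGraph W) : SimpleGraph (V ⊕ W) :=
  (G ⊕g H) ⊔ completeBipartiteGraph V W

/-- The set of graphs with vertex set `Fin n` that are isomorphic to `G`. Sets of `n`-vertex graphs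
"up to isomorphism" are represented by isomorphism-closed sets of graphs on `Fin n`. -/
def isoClass (n : ℕ) {V : Type*} (G : SimpleGraph V) : Set (SimpleGraph (Fin n)) :=
  {H | Nonempty (H ≃g G)}

open Classical in
/-- The spectral radius `ρ(G)`: the largest (real) eigenvalue of the adjacency matrix of `G`. -/
noncomputable def rho {V : Type*} [Fintype V] (G : SimpleGraph V) : ℝ :=
  sSup (spectrum ℝ (G.adjMatrix ℝ))

/-- `SPEX(n, F)`: the `F`-free graphs of order `n` whose spectral radius is maximum among all
`F`-free graphs of order `n`. -/
def SPEX {V : Type*} (n : ℕ) (F : SimpleGraph V) : Set (SimpleGraph (Fin n)) :=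
  {G | F.Free G ∧ ∀ G' : SimpleGraph (Fin n), F.Free G' → rho G' ≤ rho G}

/-- A family of finite graphs. -/
abbrev GraphFamily : Type := Set (Σ k : ℕ, SimpleGraph (Fin k))

/-- `G` contains no copy (as a not necessarily induced subgraph) of a member of `𝒜`. -/
def FamilyFree {W : Type*} (𝒜 : GraphFamily) (G : SimpleGraph W) : Prop :=
  ∀ H ∈ 𝒜, H.2.Free G

open Classical in
/-- `EX(n, 𝒜)`: the `𝒜`-free graphs of order `n` with the maximum number of edges. -/
def EX (n : ℕ) (𝒜 : GraphFamily) : Set (SimpleGraph (Fin n)) :=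
  {Q | Q.IsExtremal (FamilyFree 𝒜)}

open Classical in
/-- The family `𝒜`: it is `{K_{q+1}}` if `β(F) = q + 1`, and otherwise it consists of the induced
subgraphs `F[S]` where `S` is a covering (vertex cover) of `F` with `|S| ≤ q`. Members are taken up
to isomorphism. -/
noncomputable def coverFamily {V : Type*} (F : SimpleGraph V) (q : ℕ) : GraphFamily :=
  if F.vertexCoverNum = ((q + 1 : ℕ) : ℕ∞) then
    {H | Nonempty (H.2 ≃g (⊤ : SimpleGraph (Fin (q + 1))))}
  else
    {H | ∃ S : Finset V, F.IsVertexCover (S : Set V) ∧ S.card ≤ q ∧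
      Nonempty (H.2 ≃g F.induce (S : Set V))}

/-- `ℋ(n, q, 𝒜)`: the graphs of order `n` of the form `Q ∇ (n - q)K₁` with `Q ∈ EX(q, 𝒜)`. -/
def joinFamily (n q : ℕ) (𝒜 : GraphFamily) : Set (SimpleGraph (Fin n)) :=
  {G | ∃ Q ∈ EX q 𝒜, Nonempty (G ≃g join Q (⊥ : SimpleGraph (Fin (n - q))))}

/-- `S_{n,k}^0 = K_k ∇ (n - k)K₁`. -/
def S0 (n k : ℕ) : SimpleGraph (Fin k ⊕ Fin (n - k)) :=
  join (⊤ : SimpleGraph (Fin k)) (⊥ : SimpleGraph (Fin (n - k)))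

open Classical in
/-- The minimum of the degrees `d_F(x)` over `x ∈ A` (used for nonempty `A`). -/
noncomputable def minDegreeOn {V : Type*} [Fintype V] (F : SimpleGraph V) (A : Finset V) : ℕ :=
  sInf ((fun x => F.degree x) '' (A : Set V))

end SpectralTree

/-!
`F`-free graphs have orientations of bounded out-degree, so `ρ = O(√n)`. Suppose some `a ∈ A` is a
leaf. Since `K_{q,n-q}` is `F`-free, an extremal graph `G` has `ρ(G) ^ 2 ≥ q * (n - q)`, and near
equality in Cauchy-Schwarz yields a set `L` of `q` vertices with almost all vertices as common
neighbours. Embedding `F` with `a` outside `L` shows that the common neighbours of `L` have no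
neighbours outside `L`. Hence replacing `G` by the join of `G[L]` with an edgeless graph creates no
copy of `F`, and it increases `ρ` unless `G` is this join already. Among the joins
`Q ∇ (n - q)K₁`, being `F`-free means that `Q` is free of the cover family, and for large `n` the
spectral radius is decided by the number of edges of `Q`.

If instead all vertices of `A` have degree at least `2`, then counting edges of forests shows that
an edge may be added to the independent part of `K_q ∇ (n - q)K₁` without creating a copy of `F`,
so no join `Q ∇ (n - q)K₁` is extremal.
-/

namespace SpectralTree

open SimpleGraph Finset Filter Matrix
open scoped Classical

section Embedding

variable {V α : Type*} {F : SimpleGraph V} {G : SimpleGraph α} {A B : Finset V}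

theorem exists_injOn_of_card_le [Nonempty α] {s : Finset V} {t : Finset α} (h : #s ≤ #t) :
    ∃ f : V → α, (∀ v ∈ s, f v ∈ t) ∧ Set.InjOn f s :=
  s.finite_toSet.exists_injOn_of_encard_le (t := (t : Set α)) (by simpa using h)

theorem injOn_update_insert {f : V → α} {s : Finset V} (hf : Set.InjOn f s) {a : V} {r : α}
    (ha : a ∉ s) (hr : ∀ v ∈ s, f v ≠ r) : Set.InjOn (Function.update f a r) (insert a s) := by
  have heq : Set.EqOn f (Function.update f a r) s := fun v hv =>
    (Function.update_of_ne (ne_of_mem_of_not_mem hv ha) ..).symm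
  refine (Set.injOn_insert ha).2 ⟨hf.congr heq, ?_⟩
  rintro ⟨v, hv, hvr⟩
  rw [← heq hv, Function.update_self] at hvr
  exact hr v hv hvr

theorem isContained_of_isVertexCover [Fintype V] {S : Finset V} (hS : F.IsVertexCover (S : Set V))
    {g : V → α} (hg : Set.InjOn g S) (hadj : ∀ u ∈ S, ∀ v ∈ S, F.Adj u v → G.Adj (g u) (g v))
    {W : Finset α} (hW : ∀ u ∈ S, ∀ v ∉ S, F.Adj u v → ∀ w ∈ W, G.Adj (g u) w)
    (hcard : Fintype.card V ≤ #W) : F ⊑ G := by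
  rcases isEmpty_or_nonempty V with hV | ⟨⟨v₀⟩⟩
  · exact .of_isEmpty
  have : Nonempty α := ⟨g v₀⟩
  have hroom : #Sᶜ ≤ #(W \ S.image g) := by
    have := le_card_sdiff (S.image g) W
    rw [card_compl]
    have := card_image_le (s := S) (f := g)
    lia
  obtain ⟨f, hfW, hf⟩ := exists_injOn_of_card_le hroom
  simp only [mem_compl, Finset.mem_sdiff, mem_image, not_exists, not_and] at hfW
  have hcross : ∀ u ∈ S, ∀ v ∉ S, F.Adj u v → G.Adj (S.piecewise g f u) (S.piecewise g f v) := by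
    intro u hu v hv huv
    simpa [hu, hv] using hW u hu v hv huv _ (hfW v hv).1
  refine ⟨⟨⟨S.piecewise g f, fun {u v} huv => ?_⟩, ?_⟩⟩
  · by_cases hu : u ∈ S <;> by_cases hv : v ∈ S
    · simpa [hu, hv] using hadj u hu v hv huv
    · exact hcross u hu v hv huv
    · exact (hcross v hv u hu huv.symm).symm
    · exact absurd (hS huv) (by simp [hu, hv])
  · have := Set.injective_piecewise_iff (s := (S : Set V)).2 ⟨hg, by simpa using hf,
      fun u hu v hv huv => (hfW v hv).2 u hu huv⟩
    rwa [Finset.piecewise_coe] at this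

theorem isContained_of_card_le_degree [Nonempty α] [Fintype α] [Fintype V] (hF : F.IsTree)
    (hG : ∀ v, Fintype.card V ≤ G.degree v) : F ⊑ G := by
  induction hn : Fintype.card V generalizing V with
  | zero => exact absurd hn (@Fintype.card_ne_zero V _ hF.connected.nonempty)
  | succ n ih =>
    rcases subsingleton_or_nontrivial V with hV | hV
    · let v : α := Classical.arbitrary α
      exact ⟨⟨⟨fun _ => v, fun {a b} hab => absurd (Subsingleton.elim a b) hab.ne⟩,
        fun a b _ => Subsingleton.elim a b⟩⟩
    obtain ⟨x, hx⟩ := hF.exists_vert_degree_one_of_nontrivial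
    obtain ⟨y, -, hy⟩ := degree_eq_one_iff_existsUnique_adj.1 hx
    have hcard : Fintype.card ({x}ᶜ : Set V) = n := by
      rw [Fintype.card_compl_set, hn]
      simp
    obtain ⟨φ⟩ : F.induce {x}ᶜ ⊑ G :=
      ih ⟨hF.connected.induce_compl_singleton_of_degree_eq_one hx, hF.isAcyclic.induce _⟩
        (fun v => by have := hG v; lia) hcard
    let g : V → α := Function.extend Subtype.val φ fun _ => Classical.arbitrary α
    have hgφ : ∀ (v : V) (hv : v ≠ x), g v = φ ⟨v, hv⟩ := fun v hv =>
      Subtype.val_injective.extend_apply φ _ (⟨v, hv⟩ : ({x}ᶜ : Set V))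
    refine isContained_of_isVertexCover (S := {x}ᶜ) (g := g) (W := G.neighborFinset (g y))
      ?_ ?_ ?_ ?_ (by rw [card_neighborFinset_eq_degree]; exact hG _)
    · intro u v huv
      by_contra! h
      simp only [coe_compl, coe_singleton, Set.mem_compl_iff, Set.mem_singleton_iff, not_not] at h
      exact huv.ne (h.1.trans h.2.symm)
    · intro u hu v hv huv
      simp only [coe_compl, coe_singleton, Set.mem_compl_iff, Set.mem_singleton_iff] at hu hv
      rw [hgφ u hu, hgφ v hv] at huv
      exact congrArg Subtype.val (φ.injective huv)
    · intro u hu v hv huv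
      simp only [mem_compl, mem_singleton] at hu hv
      rw [hgφ u hu, hgφ v hv]
      exact φ.toHom.map_adj huv
    · intro u hu v hv huv w hw
      simp only [mem_compl, mem_singleton, not_not] at hu hv
      rw [hy u (hv ▸ huv.symm)]
      simpa using hw

theorem isVertexCover_left (hbip : F.IsBipartiteWith (A : Set V) (B : Set V)) :
    F.IsVertexCover (A : Set V) := fun _ _ huv =>
  (hbip.mem_of_adj huv).imp And.left And.right

/-- The vertices adjacent to every vertex of `T`. -/
noncomputable def commonNeighborFinset [Fintype α] (G : SimpleGraph α) (T : Finset α) : Finset α :=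
  {v | ∀ t ∈ T, G.Adj t v}

theorem mem_commonNeighborFinset [Fintype α] {T : Finset α} {v : α} :
    v ∈ commonNeighborFinset G T ↔ ∀ t ∈ T, G.Adj t v := by
  simp [commonNeighborFinset]

theorem card_commonNeighborFinset_le [Fintype V] [Fintype α]
    (hbip : F.IsBipartiteWith (A : Set V) (B : Set V)) (hfree : F.Free G) {T : Finset α}
    (hT : #T = #A) : #(commonNeighborFinset G T) ≤ Fintype.card V := by
  by_contra! hlt
  obtain ⟨v, -⟩ := card_pos.1 (Nat.zero_lt_of_lt hlt)
  have : Nonempty α := ⟨v⟩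
  obtain ⟨g, hgT, hg⟩ := exists_injOn_of_card_le hT.ge
  refine hfree (isContained_of_isVertexCover (isVertexCover_left hbip) hg ?_ ?_ hlt.le)
  · exact fun u hu v hv huv => absurd hv (Set.disjoint_right.1 hbip.disjoint
      (hbip.mem_of_mem_adj hu huv))
  · exact fun u hu _ _ _ w hw => mem_commonNeighborFinset.1 hw _ (hgT u hu)

/- The leaf `a` goes to `r`, its neighbour to `w`, and the rest of `A` into `L`; only common
neighbours of `L` are then needed for `B`. -/
theorem isContained_of_leaf [Fintype V] (hbip : F.IsBipartiteWith (A : Set V) (B : Set V))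
    {a b : V} (ha : a ∈ A) (hab : F.Adj a b) (hleaf : ∀ v, F.Adj a v → v = b) {L W : Finset α}
    (hL : #A ≤ #L + 1) (hLW : ∀ l ∈ L, ∀ w ∈ W, G.Adj l w) (hW : Fintype.card V ≤ #W)
    {w r : α} (hw : w ∈ W) (hr : r ∉ L) (hwr : G.Adj w r) : F ⊑ G := by
  have hdisj : ∀ v ∈ A, v ∉ B := fun v hA hB => Set.disjoint_left.1 hbip.disjoint hA hB
  have hbB : b ∈ B := hbip.mem_of_mem_adj ha hab
  have hbA : b ∉ A := fun h => hdisj b h hbB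
  have hwL : w ∉ L := fun h => (hLW w h w hw).ne rfl
  have : Nonempty α := ⟨w⟩
  obtain ⟨f, hfL, hf⟩ := exists_injOn_of_card_le (s := A.erase a) (t := L)
    (by rw [card_erase_of_mem ha]; lia)
  let g := Function.update (Function.update f a r) b w
  have hgb : g b = w := Function.update_self ..
  have hga : g a = r := by simp [g, Function.update_of_ne hab.ne]
  have hgL : ∀ v ∈ A, v ≠ a → g v ∈ L := fun v hv hva => by
    have hvb : v ≠ b := fun h => hbA (h ▸ hv)
    simpa [g, hvb, hva] using hfL v (mem_erase.2 ⟨hva, hv⟩)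
  have hg : Set.InjOn g (insert b A : Finset V) := by
    rw [coe_insert]
    refine injOn_update_insert ?_ hbA fun v hv => ?_
    · rw [← insert_erase ha, coe_insert]
      exact injOn_update_insert hf (by simp) fun v hv h => hr (h ▸ hfL v hv)
    · by_cases hva : v = a
      · simpa [hva] using hwr.ne'
      · rw [Function.update_of_ne hva]
        exact fun h => hwL (h ▸ hfL v (mem_erase.2 ⟨hva, hv⟩))
  have hAb : ∀ v ∈ A, G.Adj (g v) w := fun v hv => by
    by_cases hva : v = a
    · rw [hva, hga]; exact hwr.symm
    · exact hLW _ (hgL v hv hva) w hw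
  refine isContained_of_isVertexCover (S := insert b A) (W := W)
    ((isVertexCover_left hbip).subset (by simp)) hg ?_ ?_ hW
  · intro u hu v hv huv
    rcases mem_insert.1 hu with hub | huA <;> rcases mem_insert.1 hv with hvb | hvA
    · exact absurd (hub.trans hvb.symm) huv.ne
    · rw [hub, hgb]; exact (hAb v hvA).symm
    · rw [hvb, hgb]; exact hAb u huA
    · exact absurd (hbip.mem_of_mem_adj huA huv) (hdisj v hvA)
  · intro u hu v hv huv x hx
    rw [mem_insert, not_or] at hv
    rcases mem_insert.1 hu with rfl | hu
    · exact absurd (hbip.mem_of_mem_adj' hbB huv.symm) hv.2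
    · exact hLW _ (hgL u hu fun hua => hv.1 (hleaf v (hua ▸ huv))) x hx

end Embedding

section Orientation

variable {V α : Type*} {G : SimpleGraph α} {C : ℕ}

/-- `G` has an orientation with all out-degrees at most `C`. The out-neighbours of `v` are listed in
`D v`, which may also contain non-neighbours of `v`. -/
def HasBoundedOrientation (G : SimpleGraph α) (C : ℕ) : Prop :=
  ∃ D : α → Finset α, (∀ v, #(D v) ≤ C) ∧ ∀ u v, G.Adj u v → v ∈ D u ∨ u ∈ D v

theorem hasBoundedOrientation_of_free [Fintype V] [Finite α] {F : SimpleGraph V} (hF : F.IsTree)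
    (hfree : F.Free G) : HasBoundedOrientation G (Fintype.card V) := by
  have := Fintype.ofFinite α
  suffices ∀ S : Finset α, ∃ D : α → Finset α, (∀ v, #(D v) ≤ Fintype.card V) ∧
      ∀ u ∈ S, ∀ v ∈ S, G.Adj u v → v ∈ D u ∨ u ∈ D v by
    obtain ⟨D, hD, hadj⟩ := this univ
    exact ⟨D, hD, fun u v => hadj u (mem_univ u) v (mem_univ v)⟩
  intro S
  induction S using Finset.strongInduction with
  | H S ih =>
    rcases S.eq_empty_or_nonempty with rfl | ⟨s, hs⟩
    · exact ⟨fun _ => ∅, by simp, by simp⟩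
    have : Nonempty (S : Set α) := ⟨⟨s, hs⟩⟩
    obtain ⟨⟨v, hv⟩, hlow⟩ : ∃ v, (G.induce (S : Set α)).degree v < Fintype.card V := by
      by_contra! h
      exact hfree ((isContained_of_card_le_degree hF h).trans ⟨Copy.induce G S⟩)
    obtain ⟨D, hD, hadj⟩ := ih (S.erase v) (erase_ssubset hv)
    let N := ((G.induce (S : Set α)).neighborFinset ⟨v, hv⟩).map (Function.Embedding.subtype _)
    have hN : ∀ w ∈ S, G.Adj v w → w ∈ N := fun w hw hvw =>
      mem_map.2 ⟨⟨w, hw⟩, by simpa using hvw, rfl⟩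
    refine ⟨Function.update D v N, fun u => ?_, fun u hu w hw huw => ?_⟩
    · by_cases huv : u = v
      · rw [huv, Function.update_self, card_map, card_neighborFinset_eq_degree]
        exact hlow.le
      · rw [Function.update_of_ne huv]
        exact hD u
    · by_cases huv : u = v
      · rw [huv, Function.update_self]
        exact Or.inl (hN w hw (huv ▸ huw))
      · by_cases hwv : w = v
        · rw [hwv, Function.update_self]
          exact Or.inr (hN u hu (hwv ▸ huw.symm))
        · rw [Function.update_of_ne huv, Function.update_of_ne hwv]
          exact hadj u (mem_erase.2 ⟨huv, hu⟩) w (mem_erase.2 ⟨hwv, hw⟩) huw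

variable [Fintype α]

theorem HasBoundedOrientation.sum_degree_le (h : HasBoundedOrientation G C) :
    ∑ v, G.degree v ≤ 2 * C * Fintype.card α := by
  obtain ⟨D, hD, hadj⟩ := h
  have hsum : ∑ v, #(D v) ≤ Fintype.card α * C := sum_le_card_nsmul _ _ _ fun v _ => hD v
  have hin : ∑ v, #{u | v ∈ D u} = ∑ v, #(D v) := by
    simpa [bipartiteAbove, bipartiteBelow] using
      sum_card_bipartiteAbove_eq_sum_card_bipartiteBelow (s := univ) (t := univ) fun v u => v ∈ D u
  have hdeg : ∀ v, G.degree v ≤ #(D v) + #{u | v ∈ D u} := fun v => by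
    rw [← card_neighborFinset_eq_degree]
    refine (card_le_card fun u hu => ?_).trans (card_union_le _ _)
    simpa using hadj v u (by simpa using hu)
  calc ∑ v, G.degree v ≤ ∑ v, (#(D v) + #{u | v ∈ D u}) := sum_le_sum fun v _ => hdeg v
    _ ≤ 2 * C * Fintype.card α := by rw [sum_add_distrib, hin]; linarith

theorem mul_mul_two_le {t : ℝ} (ht : 0 < t) (a b : ℝ) : a * b * 2 ≤ t * a ^ 2 + b ^ 2 / t := by
  have hsq : t * a ^ 2 + b ^ 2 / t - a * b * 2 = (t * a - b) ^ 2 / t := by field_simp; ring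
  have : 0 ≤ (t * a - b) ^ 2 / t := by positivity
  linarith

theorem dotProduct_mulVec_le_of_charge {x : α → ℝ} {charge : α → α → ℝ} {c : ℝ}
    (hnonneg : ∀ u v, 0 ≤ charge u v)
    (hedge : ∀ u v, G.Adj u v → x u ≠ 0 → x v ≠ 0 → x u * x v * 2 ≤ charge u v + charge v u)
    (hsum : ∀ u, ∑ v, charge u v ≤ c * (x u * x u)) :
    x ⬝ᵥ (G.adjMatrix ℝ *ᵥ x) ≤ c * (x ⬝ᵥ x) := by
  have hpair : ∀ u v, (if G.Adj u v then x u * x v else 0) * 2 ≤ charge u v + charge v u := by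
    intro u v
    have h0 := add_nonneg (hnonneg u v) (hnonneg v u)
    by_cases h : G.Adj u v ∧ x u ≠ 0 ∧ x v ≠ 0
    · simpa [h.1] using hedge u v h.1 h.2.1 h.2.2
    · split_ifs with huv
      · have : x u * x v = 0 := by simpa [huv, or_iff_not_imp_left] using h
        rwa [this, zero_mul]
      · rwa [zero_mul]
  have htotal := sum_le_sum fun u (_ : u ∈ univ) => sum_le_sum fun v (_ : v ∈ univ) => hpair u v
  simp only [sum_add_distrib, ← sum_mul] at htotal
  rw [sum_comm (f := fun u v => charge v u)] at htotal
  have hcharge : ∑ u, ∑ v, charge u v ≤ c * (x ⬝ᵥ x) := by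
    rw [dotProduct, mul_sum]
    exact sum_le_sum fun u _ => hsum u
  rw [dotProduct_mulVec_adjMatrix]
  linarith

/- Orient the edges and split each product `2 x u * x v` by AM-GM with weight `√d` on the tail and
`1 / √d` on the head. -/
theorem HasBoundedOrientation.dotProduct_mulVec_le (h : HasBoundedOrientation G C) {x : α → ℝ}
    {d : ℝ} (hd : 0 < d) (hdeg : ∀ v, x v ≠ 0 → (#{w | G.Adj v w ∧ x w ≠ 0} : ℝ) ≤ d) :
    x ⬝ᵥ (G.adjMatrix ℝ *ᵥ x) ≤ (C + 1) * √d * (x ⬝ᵥ x) := by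
  obtain ⟨D, hD, hadj⟩ := h
  have ht : 0 < √d := Real.sqrt_pos.2 hd
  let tail (u v : α) : ℝ := if v ∈ D u then √d * x u ^ 2 else 0
  let head (u v : α) : ℝ := if x u ≠ 0 ∧ G.Adj u v ∧ x v ≠ 0 then x u ^ 2 / √d else 0
  have htail0 : ∀ u v, 0 ≤ tail u v := fun u v => by positivity
  have hhead0 : ∀ u v, 0 ≤ head u v := fun u v => by positivity
  have htail : ∀ u, ∑ v, tail u v ≤ C * √d * (x u * x u) := fun u => by
    have : (#(D u) : ℝ) ≤ C := by exact_mod_cast hD u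
    simp only [tail, sum_ite_mem, univ_inter, sum_const, nsmul_eq_mul]
    nlinarith [mul_le_mul_of_nonneg_right this (by positivity : 0 ≤ √d * x u ^ 2)]
  have hhead : ∀ u, ∑ v, head u v ≤ √d * (x u * x u) := fun u => by
    by_cases hu : x u = 0
    · simp [head, hu]
    simp only [head, hu, ne_eq, not_false_eq_true, true_and]
    rw [← sum_filter, sum_const, nsmul_eq_mul]
    calc _ ≤ d * (x u ^ 2 / √d) := mul_le_mul_of_nonneg_right (hdeg u hu) (by positivity)
      _ = √d * (x u * x u) := by
        rw [mul_div_assoc', div_eq_iff ht.ne', ← pow_two, mul_right_comm, Real.mul_self_sqrt hd.le]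
  refine dotProduct_mulVec_le_of_charge (charge := fun u v => tail u v + head u v)
    (fun u v => add_nonneg (htail0 u v) (hhead0 u v)) (fun u v huv hu hv => ?_) fun u => ?_
  · have hu' : head u v = x u ^ 2 / √d := if_pos ⟨hu, huv, hv⟩
    have hv' : head v u = x v ^ 2 / √d := if_pos ⟨hv, huv.symm, hu⟩
    rcases hadj u v huv with hD | hD
    · have : tail u v = √d * x u ^ 2 := if_pos hD
      linarith [mul_mul_two_le ht (x u) (x v), htail0 v u, hhead0 u v]
    · have : tail v u = √d * x v ^ 2 := if_pos hD
      linarith [mul_mul_two_le ht (x v) (x u), htail0 u v, hhead0 v u]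
  · rw [sum_add_distrib]
    linarith [htail u, hhead u]

end Orientation

section SpectralRadius

variable {V W : Type*} [Fintype V] [Fintype W] {G H : SimpleGraph V} {x : V → ℝ}

theorem posSemidef_rho_smul_one_sub_adjMatrix (G : SimpleGraph V) :
    (rho G • (1 : Matrix V V ℝ) - G.adjMatrix ℝ).PosSemidef := by
  have hA : (G.adjMatrix ℝ).IsHermitian := isHermitian_adjMatrix ℝ G
  rw [← Algebra.algebraMap_eq_smul_one, posSemidef_iff_isHermitian_and_spectrum_nonneg]
  refine ⟨.sub ?_ hA, ?_⟩
  · simp [Matrix.IsHermitian, Algebra.algebraMap_eq_smul_one]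
  · rw [← spectrum.singleton_sub_eq]
    rintro _ ⟨_, rfl, s, hs, rfl⟩
    have hbdd : BddAbove (spectrum ℝ (G.adjMatrix ℝ)) := by
      rw [hA.spectrum_real_eq_range_eigenvalues]
      exact (Set.finite_range _).bddAbove
    exact sub_nonneg.2 (le_csSup hbdd hs)

theorem dotProduct_rho_smul_one_sub_mulVec (G : SimpleGraph V) (x : V → ℝ) :
    star x ⬝ᵥ ((rho G • (1 : Matrix V V ℝ) - G.adjMatrix ℝ) *ᵥ x) =
      rho G * (x ⬝ᵥ x) - x ⬝ᵥ (G.adjMatrix ℝ *ᵥ x) := by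
  rw [star_trivial, sub_mulVec, smul_mulVec, one_mulVec, dotProduct_sub, dotProduct_smul,
    smul_eq_mul]

theorem dotProduct_mulVec_le_rho_mul (G : SimpleGraph V) (x : V → ℝ) :
    x ⬝ᵥ (G.adjMatrix ℝ *ᵥ x) ≤ rho G * (x ⬝ᵥ x) := by
  have := (posSemidef_rho_smul_one_sub_adjMatrix G).dotProduct_mulVec_nonneg x
  rwa [dotProduct_rho_smul_one_sub_mulVec, sub_nonneg] at this

theorem mulVec_eq_rho_smul (h : rho G * (x ⬝ᵥ x) ≤ x ⬝ᵥ (G.adjMatrix ℝ *ᵥ x)) :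
    G.adjMatrix ℝ *ᵥ x = rho G • x := by
  have hzero := (posSemidef_rho_smul_one_sub_adjMatrix G).dotProduct_mulVec_zero_iff x
  rw [dotProduct_rho_smul_one_sub_mulVec, sub_mulVec, smul_mulVec, one_mulVec, sub_eq_zero,
    sub_eq_zero] at hzero
  exact (hzero.1 (h.antisymm (dotProduct_mulVec_le_rho_mul G x))).symm

theorem dotProduct_mulVec_of_mulVec_eq_smul {c : ℝ} (hx : x ⬝ᵥ x = 1)
    (h : G.adjMatrix ℝ *ᵥ x = c • x) : x ⬝ᵥ (G.adjMatrix ℝ *ᵥ x) = c := by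
  rw [h, dotProduct_smul, hx, smul_eq_mul, mul_one]

theorem exists_nonneg_eigenvector [Nonempty V] (G : SimpleGraph V) :
    ∃ x : V → ℝ, 0 ≤ x ∧ x ⬝ᵥ x = 1 ∧ G.adjMatrix ℝ *ᵥ x = rho G • x := by
  have hmem : rho G ∈ spectrum ℝ (G.adjMatrix ℝ) := by
    rw [rho, (isHermitian_adjMatrix ℝ G).spectrum_real_eq_range_eigenvalues]
    exact (Set.range_nonempty _).csSup_mem (Set.finite_range _)
  rw [← spectrum_toLin', ← Module.End.hasEigenvalue_iff_mem_spectrum] at hmem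
  obtain ⟨z, hz⟩ := hmem.exists_hasEigenvector
  have hzeig : G.adjMatrix ℝ *ᵥ z = rho G • z := by simpa using hz.apply_eq_smul
  have habs : |z| ⬝ᵥ |z| = z ⬝ᵥ z := by simp [dotProduct]
  have habs_eig : G.adjMatrix ℝ *ᵥ |z| = rho G • |z| := by
    apply mulVec_eq_rho_smul
    rw [habs, ← smul_eq_mul, ← dotProduct_smul, ← hzeig, dotProduct_mulVec_adjMatrix,
      dotProduct_mulVec_adjMatrix]
    refine sum_le_sum fun u _ => sum_le_sum fun v _ => ?_
    split_ifs
    · exact (le_abs_self _).trans_eq (abs_mul _ _)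
    · exact le_rfl
  have hpos : 0 < z ⬝ᵥ z := by
    simpa using dotProduct_star_self_pos_iff.2 hz.2
  refine ⟨(√(z ⬝ᵥ z))⁻¹ • |z|, smul_nonneg (by positivity) (abs_nonneg z), ?_, ?_⟩
  · rw [smul_dotProduct, dotProduct_smul, habs, smul_eq_mul, smul_eq_mul, ← mul_assoc, ← mul_inv,
      Real.mul_self_sqrt hpos.le, inv_mul_cancel₀ hpos.ne']
  · rw [mulVec_smul, habs_eig, smul_comm]

theorem mulVec_apply_nonneg (G : SimpleGraph V) (hx : 0 ≤ x) (v : V) :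
    0 ≤ (G.adjMatrix ℝ *ᵥ x) v := by
  rw [adjMatrix_mulVec_apply]
  exact sum_nonneg fun w _ => hx w

theorem rho_nonneg [Nonempty V] (G : SimpleGraph V) : 0 ≤ rho G := by
  obtain ⟨x, hx, hx1, heig⟩ := exists_nonneg_eigenvector G
  rw [← dotProduct_mulVec_of_mulVec_eq_smul hx1 heig]
  exact dotProduct_nonneg_of_nonneg hx (mulVec_apply_nonneg G hx)

theorem rho_congr {H : SimpleGraph W} (e : G ≃g H) : rho G = rho H := by
  have : G.adjMatrix ℝ = reindexAlgEquiv ℝ ℝ e.symm.toEquiv (H.adjMatrix ℝ) := by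
    ext u v
    exact if_congr (e.map_adj_iff (v := u) (w := v)).symm rfl rfl
  rw [rho, this, AlgEquiv.spectrum_eq, rho]

/- A neighbour of a zero of an eigenvector `x ≥ 0` is again a zero. -/
theorem pos_of_rho_mul_le (hG : G.Connected) (hx : 0 ≤ x) (hx0 : x ≠ 0)
    (h : rho G * (x ⬝ᵥ x) ≤ x ⬝ᵥ (G.adjMatrix ℝ *ᵥ x)) (v : V) : 0 < x v := by
  have heig := mulVec_eq_rho_smul h
  have hstep : ∀ u w, G.Adj u w → x u = 0 → x w = 0 := by
    intro u w huw hu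
    have hsum : ∑ w ∈ G.neighborFinset u, x w = 0 := by
      rw [← adjMatrix_mulVec_apply, heig, Pi.smul_apply, hu, smul_zero]
    exact (sum_eq_zero_iff_of_nonneg fun w _ => hx w).1 hsum w (by simpa using huw)
  by_contra! hv
  refine hx0 (funext fun w => ?_)
  obtain ⟨p⟩ := hG.preconnected v w
  have hv0 : x v = 0 := le_antisymm hv (hx v)
  induction p with
  | nil => exact hv0
  | cons hadj _ ih => exact ih ((hstep _ _ hadj hv0).le) (hstep _ _ hadj hv0)

theorem dotProduct_mulVec_mono (h : G ≤ H) (hx : 0 ≤ x) :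
    x ⬝ᵥ (G.adjMatrix ℝ *ᵥ x) ≤ x ⬝ᵥ (H.adjMatrix ℝ *ᵥ x) := by
  refine dotProduct_le_dotProduct_of_nonneg_left (fun v => ?_) hx
  rw [adjMatrix_mulVec_apply, adjMatrix_mulVec_apply]
  exact sum_le_sum_of_subset_of_nonneg (fun w => by simpa using @h v w) fun w _ _ => hx w

theorem dotProduct_mulVec_lt_of_lt (h : G < H) (hx : ∀ v, 0 < x v) :
    x ⬝ᵥ (G.adjMatrix ℝ *ᵥ x) < x ⬝ᵥ (H.adjMatrix ℝ *ᵥ x) := by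
  obtain ⟨u, v, huv, hnuv⟩ : ∃ u v, H.Adj u v ∧ ¬ G.Adj u v := by
    by_contra! hc
    exact h.not_ge fun a b => hc a b
  have hle : ∀ a b, (if G.Adj a b then x a * x b else 0) ≤ if H.Adj a b then x a * x b else 0 :=
    fun a b => by
      have := mul_pos (hx a) (hx b)
      split_ifs with hG hH
      exacts [le_rfl, absurd (h.le hG) hH, this.le, le_rfl]
  rw [dotProduct_mulVec_adjMatrix, dotProduct_mulVec_adjMatrix]
  refine sum_lt_sum (fun a _ => sum_le_sum fun b _ => hle a b)
    ⟨u, mem_univ u, sum_lt_sum (fun b _ => hle u b) ⟨v, mem_univ v, ?_⟩⟩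
  simpa [huv, hnuv] using mul_pos (hx u) (hx v)

theorem rho_lt_of_lt (h : G < H) (hH : H.Connected) : rho G < rho H := by
  have := hH.nonempty
  obtain ⟨x, hx, hx1, heig⟩ := exists_nonneg_eigenvector G
  by_contra! hle
  have hGx := dotProduct_mulVec_of_mulVec_eq_smul hx1 heig
  have hpos := pos_of_rho_mul_le (x := x) hH hx (fun h0 => by simp [h0] at hx1) (by
    linarith [dotProduct_mulVec_mono h.le hx, congrArg (rho H * ·) hx1])
  have hlt := (dotProduct_mulVec_lt_of_lt h hpos).trans_le (dotProduct_mulVec_le_rho_mul H x)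
  rw [hGx, hx1, mul_one] at hlt
  exact hlt.not_ge hle

theorem HasBoundedOrientation.rho_le [Nonempty V] {C : ℕ} (h : HasBoundedOrientation G C) :
    rho G ≤ (C + 1) * √(Fintype.card V) := by
  obtain ⟨x, -, hx1, heig⟩ := exists_nonneg_eigenvector G
  have := h.dotProduct_mulVec_le (x := x) (d := Fintype.card V) (by exact_mod_cast Fintype.card_pos)
    fun v _ => by exact_mod_cast card_le_univ _
  rwa [dotProduct_mulVec_of_mulVec_eq_smul hx1 heig, hx1, mul_one] at this

end SpectralRadius

section Stability

variable {α : Type*} {G : SimpleGraph α} {C q : ℕ}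

/- Cauchy-Schwarz gives `(∑ u ∈ T, x u) ^ 2 ≤ q * b`; near equality determines `T`. -/
theorem card_eq_and_eq_filter_of_le_sq_sum (hq : 0 < q) {T H : Finset α} {x : α → ℝ} {b : ℝ}
    (hb : 0 < b) (hbH : ∑ u ∈ H, x u ^ 2 = b) (hT : T ⊆ H) (hTq : #T ≤ q)
    (h : (q - 1 / 10) * b ≤ (∑ u ∈ T, x u) ^ 2) :
    #T = q ∧ T = {u ∈ H | b < 10 * q * x u ^ 2} := by
  have hq0 : (0 : ℝ) < q := by exact_mod_cast hq
  have hsplit := sum_sdiff (f := fun u => x u ^ 2) hT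
  have hdiff : 0 ≤ ∑ u ∈ H \ T, x u ^ 2 := sum_nonneg fun u _ => sq_nonneg (x u)
  have hcs : (∑ u ∈ T, x u) ^ 2 ≤ #T * ∑ u ∈ T, x u ^ 2 := sq_sum_le_card_mul_sum_sq
  have hcard : #T = q := by
    refine hTq.antisymm ?_
    by_contra! hlt
    have : (#T : ℝ) + 1 ≤ q := by exact_mod_cast hlt
    nlinarith [(Nat.cast_nonneg #T : (0 : ℝ) ≤ #T)]
  refine ⟨hcard, ?_⟩
  set s := ∑ u ∈ T, x u
  set p := ∑ u ∈ T, x u ^ 2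
  rw [hcard] at hcs
  have hvar : ∑ u ∈ T, (q * x u - s) ^ 2 = q * (q * p - s ^ 2) := by
    simp only [sub_sq, sum_add_distrib, sum_sub_distrib, mul_pow, ← mul_sum, ← sum_mul, sum_const,
      nsmul_eq_mul, hcard, mul_assoc]
    ring
  have hin : ∀ u ∈ T, b < 10 * q * x u ^ 2 := fun u hu => by
    have hu : (q * x u - s) ^ 2 ≤ q * (q * p - s ^ 2) :=
      hvar ▸ single_le_sum (fun v _ => sq_nonneg (q * x v - s)) hu
    have hpb : (q : ℝ) * (q * p - s ^ 2) ≤ q * (b / 10) := by gcongr; nlinarith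
    have hsq : s ^ 2 ≤ 2 * (q * x u - s) ^ 2 + 2 * (q * x u) ^ 2 := by
      nlinarith [sq_nonneg (s - 2 * (q * x u))]
    have hq1 : (1 : ℝ) ≤ q := by exact_mod_cast hq
    have : (q : ℝ) * b < q * (10 * q * x u ^ 2) := by nlinarith
    exact lt_of_mul_lt_mul_left this hq0.le
  have hout : ∀ u ∈ H, u ∉ T → 10 * q * x u ^ 2 ≤ b := fun u hu huT => by
    have : x u ^ 2 ≤ ∑ v ∈ H \ T, x v ^ 2 :=
      single_le_sum (f := fun v => x v ^ 2) (fun v _ => sq_nonneg (x v))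
        (Finset.mem_sdiff.2 ⟨hu, huT⟩)
    nlinarith
  ext u
  rw [mem_filter]
  exact ⟨fun hu => ⟨hT hu, hin u hu⟩, fun hu => by_contra fun huT => hu.2.not_ge (hout u hu.1 huT)⟩

theorem sq_sum_le_ite_mul {T H : Finset α} (hT : T ⊆ H) {y : α → ℝ} {b : ℝ} (hb : 0 < b)
    (hbH : ∑ u ∈ H, y u ^ 2 = b) : (∑ u ∈ T, y u) ^ 2 ≤ ((if q < #T then (#H : ℝ) else 0) + q -
      if (∑ u ∈ T, y u) ^ 2 < (q - 1 / 10) * b then 1 / 10 else 0) * b := by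
  have hcs : (∑ u ∈ T, y u) ^ 2 ≤ #T * b := sq_sum_le_card_mul_sum_sq.trans <|
    mul_le_mul_of_nonneg_left (hbH ▸ sum_le_sum_of_subset_of_nonneg hT fun _ _ _ => sq_nonneg _)
      (Nat.cast_nonneg _)
  split_ifs with hcard hlow hlow
  · nlinarith
  · have : (#T : ℝ) ≤ #H := by exact_mod_cast card_le_card hT
    nlinarith [(Nat.cast_nonneg q : (0 : ℝ) ≤ q)]
  · linarith
  · have : (#T : ℝ) ≤ q := by exact_mod_cast not_lt.1 hcard
    nlinarith

variable [Fintype α]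

theorem mulVec_apply_of_support {H : Finset α} {y : α → ℝ} (hy : ∀ u ∉ H, y u = 0) (v : α) :
    (G.adjMatrix ℝ *ᵥ y) v = ∑ u ∈ H with G.Adj u v, y u := by
  rw [adjMatrix_mulVec_apply]
  refine (sum_subset (fun u hu => ?_) fun u hu huH => hy u fun h => huH ?_).symm
  · simpa using (mem_filter.1 hu).2.symm
  · simpa [h, G.adj_comm] using hu

theorem card_filter_lt_card_le (H : Finset α)
    (hcommon : ∀ T : Finset α, #T = q + 1 → #(commonNeighborFinset G T) ≤ C) :
    #{v | q < #{u ∈ H | G.Adj u v}} ≤ 2 ^ #H * C := by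
  have hsub : ({v | q < #{u ∈ H | G.Adj u v}} : Finset α) ⊆
      (H.powersetCard (q + 1)).biUnion (commonNeighborFinset G) := by
    intro v hv
    obtain ⟨T, hT, hTcard⟩ := exists_subset_card_eq (mem_filter.1 hv).2
    simp only [mem_biUnion, mem_powersetCard, mem_commonNeighborFinset]
    exact ⟨T, ⟨hT.trans (filter_subset _ _), hTcard⟩, fun t ht => (mem_filter.1 (hT ht)).2⟩
  calc _ ≤ #(H.powersetCard (q + 1)) * C := (card_le_card hsub).trans <|
        card_biUnion_le_card_mul _ _ C fun T hT => hcommon T (mem_powersetCard.1 hT).2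
    _ ≤ 2 ^ #H * C := by
        gcongr
        exact card_powersetCard _ H ▸ Nat.choose_le_two_pow _ _

theorem exists_card_commonNeighborFinset_of_sum_sq (hq : 0 < q) {H : Finset α} {y : α → ℝ} {b η : ℝ}
    (hb : 0 < b) (hbH : ∑ u ∈ H, y u ^ 2 = b)
    (hbad : (#{v | q < #{u ∈ H | G.Adj u v}} * #H : ℝ) ≤ η * Fintype.card α)
    (hsum : (q - η) * Fintype.card α * b ≤ ∑ v, (∑ u ∈ H with G.Adj u v, y u) ^ 2)
    (hη : 21 * η < 1) (hα : 0 < Fintype.card α) :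
    ∃ L : Finset α, #L = q ∧ (1 - 21 * η) * Fintype.card α ≤ #(commonNeighborFinset G L) := by
  let T (v : α) : Finset α := {u ∈ H | G.Adj u v}
  let B : Finset α := {v | q < #(T v)}
  let X : Finset α := {v | (∑ u ∈ T v, y u) ^ 2 < (q - 1 / 10) * b}
  have hXcard : (#X : ℝ) ≤ 20 * η * Fintype.card α := by
    have := hsum.trans (sum_le_sum fun v _ =>
      sq_sum_le_ite_mul (q := q) (filter_subset (G.Adj · v) H) hb hbH)
    rw [← sum_mul, mul_le_mul_iff_left₀ hb] at this
    simp only [sum_sub_distrib, sum_add_distrib, ← sum_filter, sum_const, nsmul_eq_mul,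
      card_univ] at this
    linarith
  have hBcard : (#B : ℝ) ≤ η * Fintype.card α := by
    refine le_trans ?_ hbad
    rcases B.eq_empty_or_nonempty with hB | ⟨v, hv⟩
    · rw [hB, card_empty, Nat.cast_zero]
      positivity
    · have : 1 ≤ #H := Nat.one_le_iff_ne_zero.2 fun h0 => by
        have := (mem_filter.1 hv).2.trans_le (card_le_card (filter_subset _ H))
        lia
      exact le_mul_of_one_le_right (Nat.cast_nonneg _) (by exact_mod_cast this)
  have hgood : (1 - 21 * η) * Fintype.card α ≤ #(X ∪ B)ᶜ := by
    have h1 : (#(X ∪ B) : ℝ) ≤ #X + #B := by exact_mod_cast card_union_le X B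
    have h2 : (#(X ∪ B) : ℝ) + #(X ∪ B)ᶜ = Fintype.card α := by
      exact_mod_cast card_add_card_compl (X ∪ B)
    linarith
  have hT : ∀ v ∈ (X ∪ B)ᶜ, #(T v) = q ∧ T v = {u ∈ H | b < 10 * q * y u ^ 2} := by
    intro v hv
    simp only [mem_compl, mem_union, not_or, X, B, mem_filter, mem_univ, true_and, not_lt] at hv
    exact card_eq_and_eq_filter_of_le_sq_sum hq hb hbH (filter_subset _ _) hv.2 hv.1
  obtain ⟨v, hv⟩ : (X ∪ B)ᶜ.Nonempty := by
    have : (0 : ℝ) < Fintype.card α := by exact_mod_cast hα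
    rw [← card_pos, ← Nat.cast_pos (α := ℝ)]
    exact lt_of_lt_of_le (mul_pos (by linarith) this) hgood
  refine ⟨T v, (hT v hv).1, hgood.trans ?_⟩
  norm_cast
  refine card_le_card fun w hw => mem_commonNeighborFinset.2 fun l hl => ?_
  rw [(hT v hv).2, ← (hT w hw).2] at hl
  exact (mem_filter.1 hl).2

theorem sq_mul_dotProduct_le {r : ℝ} {y z w : α → ℝ} (hnorm : z ⬝ᵥ z + y ⬝ᵥ y = 1) (hr : 0 ≤ r)
    (hrw : r ≤ 2 * (z ⬝ᵥ w)) : r ^ 2 * (y ⬝ᵥ y) ≤ w ⬝ᵥ w := by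
  have hy0 : 0 ≤ y ⬝ᵥ y := by simpa using dotProduct_star_self_nonneg y
  have hw0 : 0 ≤ w ⬝ᵥ w := by simpa using dotProduct_star_self_nonneg w
  have hcs : (z ⬝ᵥ w) ^ 2 ≤ (z ⬝ᵥ z) * (w ⬝ᵥ w) := by
    simpa only [dotProduct, ← pow_two] using sum_mul_sq_le_sq_mul_sq univ z w
  have hamgm : 4 * (z ⬝ᵥ z) * (y ⬝ᵥ y) ≤ 1 := by nlinarith [sq_nonneg (z ⬝ᵥ z - y ⬝ᵥ y)]
  calc r ^ 2 * (y ⬝ᵥ y) ≤ (2 * (z ⬝ᵥ w)) ^ 2 * (y ⬝ᵥ y) := by gcongr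
    _ ≤ 4 * (z ⬝ᵥ z) * (y ⬝ᵥ y) * (w ⬝ᵥ w) := by nlinarith
    _ ≤ w ⬝ᵥ w := mul_le_of_le_one_left hw0 hamgm

theorem HasBoundedOrientation.exists_mulVec_large [Nonempty α] (h : HasBoundedOrientation G C)
    {H : Finset α} {d : ℝ} (hd : 0 < d) (hH : #H ≤ d) (hdeg : ∀ v ∉ H, G.degree v ≤ d)
    (hrho : (C + 1) * √d < rho G) :
    ∃ y : α → ℝ, (∀ v ∉ H, y v = 0) ∧ 0 < y ⬝ᵥ y ∧ (rho G - (C + 1) * √d) ^ 2 * (y ⬝ᵥ y) ≤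
      (G.adjMatrix ℝ *ᵥ y) ⬝ᵥ (G.adjMatrix ℝ *ᵥ y) := by
  obtain ⟨x, -, hx1, heig⟩ := exists_nonneg_eigenvector G
  let y (v : α) : ℝ := if v ∈ H then x v else 0
  let z (v : α) : ℝ := if v ∈ H then 0 else x v
  have hyz : x = z + y := by
    ext v
    by_cases hv : v ∈ H <;> simp [y, z, hv]
  have hzy : z ⬝ᵥ y = 0 := sum_eq_zero fun v _ => by
    by_cases hv : v ∈ H <;> simp [y, z, hv]
  have hnorm : z ⬝ᵥ z + y ⬝ᵥ y = 1 := by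
    rw [← hx1, hyz, add_dotProduct, dotProduct_add, dotProduct_add, dotProduct_comm y z, hzy]
    ring
  have hsymm : y ⬝ᵥ (G.adjMatrix ℝ *ᵥ z) = z ⬝ᵥ (G.adjMatrix ℝ *ᵥ y) := by
    rw [dotProduct_mulVec, ← mulVec_transpose, transpose_adjMatrix, dotProduct_comm]
  have hquad := dotProduct_mulVec_of_mulVec_eq_smul hx1 heig
  rw [hyz, mulVec_add, add_dotProduct, dotProduct_add, dotProduct_add, hsymm] at hquad
  have hzz := h.dotProduct_mulVec_le (x := z) hd fun v hv => by
    refine le_trans ?_ (hdeg v fun hvH => hv (if_pos hvH))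
    rw [← card_neighborFinset_eq_degree]
    exact_mod_cast card_le_card fun w hw => by simpa using (mem_filter.1 hw).2.1
  have hyy := h.dotProduct_mulVec_le (x := y) hd fun v _ => by
    refine le_trans ?_ hH
    exact_mod_cast card_le_card (t := H) fun w hw =>
      by_contra fun hwH => ((mem_filter.1 hw).2 : _ ∧ y w ≠ 0).2 (if_neg hwH)
  have hcross : rho G - (C + 1) * √d ≤ 2 * (z ⬝ᵥ (G.adjMatrix ℝ *ᵥ y)) := by
    have : (C + 1) * √d * (z ⬝ᵥ z) + (C + 1) * √d * (y ⬝ᵥ y) = (C + 1) * √d := by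
      rw [← mul_add, hnorm, mul_one]
    linarith
  have hy0 : 0 ≤ y ⬝ᵥ y := by simpa using dotProduct_star_self_nonneg y
  refine ⟨y, fun v hv => if_neg hv, hy0.lt_of_ne' fun h0 => ?_,
    sq_mul_dotProduct_le hnorm (sub_pos.2 hrho).le hcross⟩
  rw [dotProduct_self_eq_zero.1 h0, mulVec_zero, dotProduct_zero] at hcross
  linarith

theorem eventually_le_mul_natCast {c : ℝ} (hc : 0 < c) (a : ℝ) : ∀ᶠ n : ℕ in atTop, a ≤ c * n :=
  (tendsto_natCast_atTop_atTop.const_mul_atTop hc).eventually_ge_atTop a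

theorem HasBoundedOrientation.card_filter_le_degree_mul_le (h : HasBoundedOrientation G C) (d : ℝ) :
    #{v | d ≤ G.degree v} * d ≤ 2 * C * Fintype.card α := by
  rw [← nsmul_eq_mul]
  refine (card_nsmul_le_sum _ (fun v => (G.degree v : ℝ)) _ fun v hv =>
    (mem_filter.1 hv).2).trans ?_
  refine (sum_le_univ_sum_of_nonneg fun v => Nat.cast_nonneg _).trans ?_
  exact_mod_cast h.sum_degree_le

theorem mul_lt_and_le_sq_sub {n : ℕ} {lam k η τ : ℝ} (hq : 0 < q) (hn : 0 < n) (hk : 1 ≤ k)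
    (hlam0 : 0 ≤ lam) (hlam : lam ≤ k * √n) (hrho : q * (n - q) ≤ lam ^ 2)
    (hτ : 4 * k ^ 2 * τ = η) (hτ0 : 0 ≤ τ) (hη : η < 1) (hqn : q ^ 2 ≤ η / 2 * n) :
    k * (τ * √n) < lam ∧ (q - η) * n ≤ (lam - k * (τ * √n)) ^ 2 := by
  have hq1 : (1 : ℝ) ≤ q := by exact_mod_cast hq
  have hn0 : (0 : ℝ) < n := by exact_mod_cast hn
  have hprod : lam * (k * (τ * √n)) ≤ η / 4 * n := by
    calc _ ≤ k * √n * (k * (τ * √n)) := mul_le_mul_of_nonneg_right hlam (by positivity)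
      _ = k ^ 2 * τ * √n ^ 2 := by ring
      _ = η / 4 * n := by rw [Real.sq_sqrt n.cast_nonneg, ← hτ]; ring
  refine ⟨?_, by nlinarith [sq_nonneg (k * (τ * √n))]⟩
  by_contra! hle
  have : (n : ℝ) ≤ q * n := le_mul_of_one_le_left hn0.le hq1
  have : η * n < 1 * n := mul_lt_mul_of_pos_right hη hn0
  nlinarith [mul_le_mul_of_nonneg_left hle hlam0]

theorem HasBoundedOrientation.exists_card_commonNeighborFinset [Nonempty α]
    (hG : HasBoundedOrientation G C) (hq : 0 < q)
    (hcommon : ∀ T : Finset α, #T = q + 1 → #(commonNeighborFinset G T) ≤ C)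
    {H : Finset α} {d η : ℝ} (hd : 0 < d) (hH : #H ≤ d) (hdeg : ∀ v ∉ H, G.degree v ≤ d)
    (hbad : (2 ^ #H * C * #H : ℝ) ≤ η * Fintype.card α) (hrho : (C + 1) * √d < rho G)
    (hlarge : (q - η) * Fintype.card α ≤ (rho G - (C + 1) * √d) ^ 2) (hη : 21 * η < 1) :
    ∃ L : Finset α, #L = q ∧ (1 - 21 * η) * Fintype.card α ≤ #(commonNeighborFinset G L) := by
  obtain ⟨y, hyH, hy0, hy⟩ := hG.exists_mulVec_large hd hH hdeg hrho
  have hnorm : ∑ u ∈ H, y u ^ 2 = y ⬝ᵥ y := by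
    simp only [dotProduct, pow_two]
    exact sum_subset (subset_univ H) fun v _ hv => by rw [hyH v hv, mul_zero]
  refine exists_card_commonNeighborFinset_of_sum_sq hq hy0 hnorm (le_trans ?_ hbad) ?_ hη
    Fintype.card_pos
  · exact_mod_cast Nat.mul_le_mul_right _ (card_filter_lt_card_le H hcommon)
  · simp only [← mulVec_apply_of_support hyH]
    refine (mul_le_mul_of_nonneg_right hlarge hy0.le).trans (hy.trans_eq ?_)
    simp only [dotProduct, pow_two]

/- Boundedly many vertices `H` have linear degree, and only edges between `H` and its complement
contribute to `ρ` in first order. -/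
theorem eventually_exists_card_commonNeighborFinset (hq : 0 < q) (C : ℕ) {ε : ℝ} (hε : 0 < ε) :
    ∀ᶠ n : ℕ in atTop, ∀ G : SimpleGraph (Fin n), HasBoundedOrientation G C →
      (∀ T : Finset (Fin n), #T = q + 1 → #(commonNeighborFinset G T) ≤ C) →
      q * (n - q) ≤ rho G ^ 2 →
      ∃ L : Finset (Fin n), #L = q ∧ (1 - ε) * n ≤ #(commonNeighborFinset G L) := by
  obtain ⟨η, hη0, hη, hηε⟩ : ∃ η : ℝ, 0 < η ∧ 21 * η < 1 ∧ 21 * η ≤ ε :=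
    ⟨min (1 / 42) (ε / 21), by positivity, by linarith [min_le_left (1 / 42 : ℝ) (ε / 21)],
      by linarith [min_le_right (1 / 42 : ℝ) (ε / 21)]⟩
  let τ : ℝ := η / (4 * (C + 1) ^ 2)
  have hτ0 : 0 < τ := by positivity
  have hτ : 4 * (C + 1) ^ 2 * τ = η := mul_div_cancel₀ _ (by positivity)
  let K : ℕ := ⌊2 * C / τ ^ 2⌋₊
  filter_upwards [eventually_gt_atTop 0, eventually_le_mul_natCast (pow_pos hτ0 2) K,
    eventually_le_mul_natCast hη0 (2 ^ K * C * K : ℕ),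
    eventually_le_mul_natCast (half_pos hη0) (q ^ 2)] with n hn hKn hbad hqn G hG hcommon hrho
  have : Nonempty (Fin n) := ⟨⟨0, hn⟩⟩
  have hn0 : (0 : ℝ) < n := by exact_mod_cast hn
  let H : Finset (Fin n) := {v | τ ^ 2 * n ≤ G.degree v}
  have hHK : #H ≤ K := by
    have := hG.card_filter_le_degree_mul_le (τ ^ 2 * n)
    rw [Fintype.card_fin, ← mul_assoc, mul_le_mul_iff_left₀ hn0,
      ← le_div_iff₀ (by positivity)] at this
    exact Nat.le_floor this
  have hsqrt : √(τ ^ 2 * n) = τ * √n := by rw [Real.sqrt_mul (by positivity), Real.sqrt_sq hτ0.le]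
  obtain ⟨hlt, hlarge⟩ : (C + 1) * √(τ ^ 2 * n) < rho G ∧
      (q - η) * n ≤ (rho G - (C + 1) * √(τ ^ 2 * n)) ^ 2 := by
    rw [hsqrt]
    exact mul_lt_and_le_sq_sub hq hn (by simp) (rho_nonneg G) (by simpa using hG.rho_le) hrho hτ
      hτ0.le (by linarith) hqn
  obtain ⟨L, hL, hLn⟩ := hG.exists_card_commonNeighborFinset (H := H) (d := τ ^ 2 * n) (η := η)
    hq hcommon (by positivity) ((Nat.cast_le.2 hHK).trans hKn)
    (fun v hv => le_of_not_ge fun h => hv (mem_filter.2 ⟨mem_univ v, h⟩))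
    (by
      rw [Fintype.card_fin]
      refine le_trans ?_ hbad
      exact_mod_cast Nat.mul_le_mul
        (Nat.mul_le_mul_right C (Nat.pow_le_pow_right (by lia) hHK)) hHK)
    hlt (by simpa using hlarge) hη
  refine ⟨L, hL, le_trans ?_ (by simpa using hLn)⟩
  gcongr

end Stability

section InducedJoin

variable {V α : Type*} {F : SimpleGraph V} {G : SimpleGraph α} {L : Finset α}

/-- The join of `G.induce L` with the edgeless graph on the complement of `L`, realized on the
vertex type of `G`. -/
def inducedJoin (G : SimpleGraph α) (L : Finset α) : SimpleGraph α where
  Adj u v := u ∈ L ∧ v ∈ L ∧ G.Adj u v ∨ u ∈ L ∧ v ∉ L ∨ u ∉ L ∧ v ∈ L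
  symm := ⟨fun u v h => by rw [G.adj_comm] at h; tauto⟩
  loopless := ⟨fun u h => by have := G.loopless.irrefl u; tauto⟩

theorem inducedJoin_adj_of_notMem {v w : α} (hv : v ∉ L) :
    (inducedJoin G L).Adj v w ↔ w ∈ L := by
  simp [inducedJoin, hv]

theorem inducedJoin_adj_of_mem {v w : α} (hv : v ∈ L) :
    (inducedJoin G L).Adj v w ↔ (w ∈ L → G.Adj v w) := by
  by_cases hw : w ∈ L <;> simp [inducedJoin, hv, hw]

theorem connected_inducedJoin (hL : L.Nonempty) {w : α} (hw : w ∉ L) :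
    (inducedJoin G L).Connected := by
  obtain ⟨l, hl⟩ := hL
  have hwL : ∀ {v}, v ∈ L → (inducedJoin G L).Reachable w v := fun hv =>
    ((inducedJoin_adj_of_notMem hw).2 hv).reachable
  refine (connected_iff_exists_forall_reachable _).2 ⟨w, fun v => ?_⟩
  by_cases hv : v ∈ L
  · exact hwL hv
  · exact (hwL hl).trans ((inducedJoin_adj_of_notMem hv).2 hl).symm.reachable

variable [Fintype α]

theorem free_inducedJoin [Fintype V] (hfree : F.Free G)
    (hW : Fintype.card V ≤ #(commonNeighborFinset G L)) : F.Free (inducedJoin G L) := by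
  rintro ⟨φ⟩
  have hadj : ∀ u v, F.Adj u v → (inducedJoin G L).Adj (φ u) (φ v) := fun u v huv =>
    φ.toHom.map_adj huv
  refine hfree (isContained_of_isVertexCover (S := {v | φ v ∈ L}) (g := φ)
    (fun u v huv => ?_) φ.injective.injOn (fun u hu v hv huv => ?_)
    (fun u hu _ _ _ w hw => mem_commonNeighborFinset.1 hw _ (mem_filter.1 hu).2) hW)
  · by_cases hu : φ u ∈ L
    · simp [hu]
    · simp [(inducedJoin_adj_of_notMem hu).1 (hadj u v huv)]
  · exact (inducedJoin_adj_of_mem (mem_filter.1 hu).2).1 (hadj u v huv) (mem_filter.1 hv).2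

/-- The vertices outside `L` that are not common neighbours of `L`. -/
noncomputable def exceptionalFinset (G : SimpleGraph α) (L : Finset α) : Finset α :=
  (L ∪ commonNeighborFinset G L)ᶜ

theorem mem_exceptionalFinset {v : α} :
    v ∈ exceptionalFinset G L ↔ v ∉ L ∧ ∃ l ∈ L, ¬ G.Adj l v := by
  simp [exceptionalFinset, mem_commonNeighborFinset]

theorem notMem_of_mem_commonNeighborFinset {v : α} (hv : v ∈ commonNeighborFinset G L) : v ∉ L :=
  fun hvL => (mem_commonNeighborFinset.1 hv v hvL).ne rfl

theorem card_add_card_add_card_exceptionalFinset (G : SimpleGraph α) (L : Finset α) :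
    #L + #(commonNeighborFinset G L) + #(exceptionalFinset G L) = Fintype.card α := by
  rw [exceptionalFinset, ← card_union_of_disjoint (Finset.disjoint_right.2 fun v =>
    notMem_of_mem_commonNeighborFinset), card_add_card_compl]

theorem eq_inducedJoin_of_exceptionalFinset_eq_empty (h : exceptionalFinset G L = ∅)
    (hW : ∀ w ∈ commonNeighborFinset G L, ∀ v, G.Adj w v → v ∈ L) : G = inducedJoin G L := by
  have hout : ∀ v ∉ L, v ∈ commonNeighborFinset G L := fun v hv => by
    have := (mem_exceptionalFinset (G := G) (L := L)).not.1 (h ▸ notMem_empty v)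
    rw [mem_commonNeighborFinset]
    grind
  ext u v
  by_cases hu : u ∈ L
  · rw [inducedJoin_adj_of_mem hu]
    exact ⟨fun huv _ => huv, fun huv => by_cases huv fun hv =>
      mem_commonNeighborFinset.1 (hout v hv) u hu⟩
  · rw [inducedJoin_adj_of_notMem hu]
    exact ⟨hW u (hout u hu) v, fun hv => (mem_commonNeighborFinset.1 (hout u hu) v hv).symm⟩

variable {x : α → ℝ}

theorem mulVec_inducedJoin_of_notMem {v : α} (hv : v ∉ L) :
    ((inducedJoin G L).adjMatrix ℝ *ᵥ x) v = ∑ l ∈ L, x l := by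
  rw [adjMatrix_mulVec_apply]
  exact sum_congr (by ext w; simp [inducedJoin_adj_of_notMem hv]) fun _ _ => rfl

theorem mulVec_le_inducedJoin_of_mem (hx : 0 ≤ x) {l : α} (hl : l ∈ L) :
    (G.adjMatrix ℝ *ᵥ x) l ≤ ((inducedJoin G L).adjMatrix ℝ *ᵥ x) l := by
  rw [adjMatrix_mulVec_apply, adjMatrix_mulVec_apply]
  refine sum_le_sum_of_subset_of_nonneg (fun w hw => ?_) fun w _ _ => hx w
  rw [mem_neighborFinset] at hw ⊢
  exact (inducedJoin_adj_of_mem hl).2 fun _ => hw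

theorem mulVec_commonNeighborFinset {w : α} (hw : w ∈ commonNeighborFinset G L)
    (hW : ∀ v, G.Adj w v → v ∈ L) : (G.adjMatrix ℝ *ᵥ x) w = ∑ l ∈ L, x l := by
  rw [adjMatrix_mulVec_apply]
  refine sum_congr (ext fun v => ?_) fun _ _ => rfl
  rw [mem_neighborFinset]
  exact ⟨hW v, fun hv => (mem_commonNeighborFinset.1 hw v hv).symm⟩

theorem card_mul_sum_le_sq_mul {c : ℝ} (hx : 0 ≤ x) (heig : G.adjMatrix ℝ *ᵥ x = c • x)
    (hc : 0 ≤ c) (hW : ∀ w ∈ commonNeighborFinset G L, ∀ v, G.Adj w v → v ∈ L) {l : α}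
    (hl : l ∈ L) : #(commonNeighborFinset G L) * ∑ l ∈ L, x l ≤ c ^ 2 * x l := by
  have hxw : ∀ w ∈ commonNeighborFinset G L, c * x w = ∑ l ∈ L, x l := fun w hw => by
    rw [← mulVec_commonNeighborFinset hw (hW w hw), heig, Pi.smul_apply, smul_eq_mul]
  have hsum : ∑ w ∈ commonNeighborFinset G L, x w ≤ c * x l := by
    rw [← smul_eq_mul, ← Pi.smul_apply, ← heig, adjMatrix_mulVec_apply]
    refine sum_le_sum_of_subset_of_nonneg (fun w hw => ?_) fun w _ _ => hx w
    simpa using mem_commonNeighborFinset.1 hw l hl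
  calc _ = c * ∑ w ∈ commonNeighborFinset G L, x w := by
        rw [← nsmul_eq_mul, ← sum_const, ← sum_congr rfl hxw, ← mul_sum]
    _ ≤ c * (c * x l) := mul_le_mul_of_nonneg_left hsum hc
    _ = c ^ 2 * x l := by ring

theorem mulVec_exceptional_le {μ : ℝ} (hx : 0 ≤ x) (hμ : ∀ l ∈ L, μ ≤ x l)
    (hW : ∀ w ∈ commonNeighborFinset G L, ∀ v, G.Adj w v → v ∈ L) {r : α}
    (hr : r ∈ exceptionalFinset G L) : (G.adjMatrix ℝ *ᵥ x) r ≤ ∑ l ∈ L, x l - μ +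
      (G.adjMatrix ℝ *ᵥ Set.indicator (exceptionalFinset G L) x) r := by
  obtain ⟨hrL, l, hl, hlr⟩ := mem_exceptionalFinset.1 hr
  have hsplit : ∀ v ∈ G.neighborFinset r, x v =
      (if v ∈ L then x v else 0) + Set.indicator (exceptionalFinset G L : Set α) x v := by
    intro v hv
    rw [mem_neighborFinset] at hv
    have hvW : v ∉ commonNeighborFinset G L := fun h => hrL (hW v h r hv.symm)
    by_cases hvL : v ∈ L <;> simp [exceptionalFinset, Set.indicator, hvL, hvW]
  have hLsum : ∑ v ∈ G.neighborFinset r, (if v ∈ L then x v else 0) ≤ ∑ v ∈ L.erase l, x v := by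
    rw [sum_ite_mem]
    refine sum_le_sum_of_subset_of_nonneg (fun v hv => ?_) fun v _ _ => hx v
    rw [mem_inter, mem_neighborFinset] at hv
    exact mem_erase.2 ⟨fun h => hlr (h ▸ hv.1.symm), hv.2⟩
  rw [adjMatrix_mulVec_apply, adjMatrix_mulVec_apply, sum_congr rfl hsplit, sum_add_distrib]
  linarith [add_sum_erase L x hl, hμ l hl]

theorem indicator_dotProduct (S : Finset α) (x y : α → ℝ) :
    Set.indicator S x ⬝ᵥ y = ∑ v ∈ S, x v * y v := by
  simp [dotProduct, Set.indicator_apply, ite_mul]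

theorem mul_sum_sub_le_sub {μ : ℝ} (hx : 0 ≤ x) (hμ : ∀ l ∈ L, μ ≤ x l)
    (hW : ∀ w ∈ commonNeighborFinset G L, ∀ v, G.Adj w v → v ∈ L) :
    μ * ∑ r ∈ exceptionalFinset G L, x r - Set.indicator (exceptionalFinset G L) x ⬝ᵥ
        (G.adjMatrix ℝ *ᵥ Set.indicator (exceptionalFinset G L) x) ≤
      x ⬝ᵥ ((inducedJoin G L).adjMatrix ℝ *ᵥ x) - x ⬝ᵥ (G.adjMatrix ℝ *ᵥ x) := by
  rw [indicator_dotProduct, mul_sum, ← sum_sub_distrib, ← dotProduct_sub, dotProduct]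
  calc _ ≤ ∑ r ∈ exceptionalFinset G L, x r *
        ((inducedJoin G L).adjMatrix ℝ *ᵥ x - G.adjMatrix ℝ *ᵥ x) r := sum_le_sum fun r hr => by
        have := mulVec_exceptional_le hx hμ hW hr
        rw [Pi.sub_apply, mulVec_inducedJoin_of_notMem (mem_exceptionalFinset.1 hr).1]
        nlinarith [mul_le_mul_of_nonneg_left this (hx r)]
    _ ≤ _ := sum_le_sum_of_subset_of_nonneg (subset_univ _) fun v _ hv => ?_
  refine mul_nonneg (hx v) (sub_nonneg.2 ?_)
  by_cases hvL : v ∈ L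
  · exact mulVec_le_inducedJoin_of_mem hx hvL
  · have hvW : v ∈ commonNeighborFinset G L := by simpa [exceptionalFinset, hvL] using hv
    rw [mulVec_inducedJoin_of_notMem hvL, mulVec_commonNeighborFinset hvW (hW v hvW)]

theorem HasBoundedOrientation.mul_dotProduct_mulVec_exceptional_le {C : ℕ} {c : ℝ}
    (h : HasBoundedOrientation G C) (hx : 0 ≤ x) (heig : G.adjMatrix ℝ *ᵥ x = c • x)
    (hW : ∀ w ∈ commonNeighborFinset G L, ∀ v, G.Adj w v → v ∈ L)
    (hR : (exceptionalFinset G L).Nonempty)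
    (hc : 2 * ((C + 1) * √(#(exceptionalFinset G L))) ≤ c) :
    c * (Set.indicator (exceptionalFinset G L) x ⬝ᵥ
        (G.adjMatrix ℝ *ᵥ Set.indicator (exceptionalFinset G L) x)) ≤
      2 * ((C + 1) * √(#(exceptionalFinset G L))) *
        ((∑ l ∈ L, x l) * ∑ r ∈ exceptionalFinset G L, x r) := by
  set R := exceptionalFinset G L
  set z : α → ℝ := Set.indicator R x
  set κ := (C + 1) * √(#R)
  have hκ : 0 ≤ κ := by positivity
  have hquad : z ⬝ᵥ (G.adjMatrix ℝ *ᵥ z) ≤ κ * (z ⬝ᵥ z) := by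
    refine h.dotProduct_mulVec_le (by exact_mod_cast hR.card_pos) fun v _ => ?_
    exact_mod_cast card_le_card fun w hw => by
      by_contra hwR
      exact (mem_filter.1 hw).2.2 (Set.indicator_of_notMem hwR x)
  have hzz : z ⬝ᵥ z = ∑ r ∈ R, x r * x r := by
    rw [indicator_dotProduct]
    exact sum_congr rfl fun r hr => by simp only [z, Set.indicator_of_mem (mem_coe.2 hr)]
  have hmass : c * (z ⬝ᵥ z) ≤ (∑ l ∈ L, x l) * (∑ r ∈ R, x r) + z ⬝ᵥ (G.adjMatrix ℝ *ᵥ z) := by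
    rw [hzz, indicator_dotProduct, mul_sum, mul_sum, ← sum_add_distrib]
    refine sum_le_sum fun r hr => ?_
    have := mulVec_exceptional_le (μ := 0) hx (fun l _ => hx l) hW hr
    rw [heig, Pi.smul_apply, smul_eq_mul] at this
    nlinarith [mul_le_mul_of_nonneg_left this (hx r)]
  have hzz0 : 0 ≤ z ⬝ᵥ z := hzz ▸ sum_nonneg fun r _ => mul_self_nonneg _
  have : c * (z ⬝ᵥ z) ≤ 2 * ((∑ l ∈ L, x l) * ∑ r ∈ R, x r) := by
    nlinarith [mul_le_mul_of_nonneg_right hc hzz0]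
  nlinarith [mul_le_mul_of_nonneg_left this hκ, mul_le_mul_of_nonneg_left hquad
    ((mul_nonneg zero_le_two hκ).trans hc)]

theorem HasBoundedOrientation.mul_sub_le_sq_mul_sub {C : ℕ} {c : ℝ}
    (h : HasBoundedOrientation G C) (hx : 0 ≤ x) (heig : G.adjMatrix ℝ *ᵥ x = c • x)
    (hc : 0 < c) (hW : ∀ w ∈ commonNeighborFinset G L, ∀ v, G.Adj w v → v ∈ L)
    (hR : (exceptionalFinset G L).Nonempty)
    (hκc : 2 * ((C + 1) * √(#(exceptionalFinset G L))) ≤ c) :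
    (∑ l ∈ L, x l) * (∑ r ∈ exceptionalFinset G L, x r) *
        (#(commonNeighborFinset G L) - 2 * ((C + 1) * √(#(exceptionalFinset G L))) * c) ≤
      c ^ 2 * (x ⬝ᵥ ((inducedJoin G L).adjMatrix ℝ *ᵥ x) - x ⬝ᵥ (G.adjMatrix ℝ *ᵥ x)) := by
  have hinternal := h.mul_dotProduct_mulVec_exceptional_le hx heig hW hR hκc
  set s := ∑ l ∈ L, x l
  set X := ∑ r ∈ exceptionalFinset G L, x r
  set Y := (#(commonNeighborFinset G L) : ℝ)
  have hbound : ∀ l ∈ L, Y * s / c ^ 2 ≤ x l := fun l hl =>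
    (div_le_iff₀' (by positivity)).2 (card_mul_sum_le_sq_mul hx heig hc.le hW hl)
  have hexp : c ^ 2 * (Y * s / c ^ 2 * X) = Y * s * X := by field_simp
  nlinarith [mul_le_mul_of_nonneg_left (mul_sum_sub_le_sub hx hbound hW) (sq_nonneg c),
    mul_le_mul_of_nonneg_left hinternal hc.le]

-- Making every exceptional vertex adjacent to all of `L` and to nothing else gains at least the
-- weight of a missing edge to `L`, which outweighs the few edges inside the exceptional set.
theorem HasBoundedOrientation.rho_lt_rho_inducedJoin {C : ℕ} (h : HasBoundedOrientation G C)
    (hL : L.Nonempty) (hW : ∀ w ∈ commonNeighborFinset G L, ∀ v, G.Adj w v → v ∈ L)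
    (hR : (exceptionalFinset G L).Nonempty)
    (hrho : 2 * ((C + 1) * √(#(exceptionalFinset G L))) ≤ rho G)
    (hcard : 2 * ((C + 1) * √(#(exceptionalFinset G L))) * rho G < #(commonNeighborFinset G L)) :
    rho G < rho (inducedJoin G L) := by
  obtain ⟨r, hr⟩ := id hR
  have : Nonempty α := ⟨r⟩
  obtain ⟨x, hx, hxx, heig⟩ := exists_nonneg_eigenvector G
  have hpos : 0 < rho G := lt_of_lt_of_le (by positivity) hrho
  have hgain := h.mul_sub_le_sq_mul_sub hx heig hpos hW hR hrho
  rw [dotProduct_mulVec_of_mulVec_eq_smul hxx heig] at hgain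
  have hle := dotProduct_mulVec_le_rho_mul (inducedJoin G L) x
  rw [hxx, mul_one] at hle
  by_contra! hcon
  have hge : rho G ≤ x ⬝ᵥ ((inducedJoin G L).adjMatrix ℝ *ᵥ x) := by
    have := (mul_nonneg (mul_nonneg (sum_nonneg fun l _ => hx l) (sum_nonneg fun r _ => hx r))
      (sub_nonneg.2 hcard.le)).trans hgain
    exact sub_nonneg.1 (nonneg_of_mul_nonneg_right this (by positivity))
  have hxpos : ∀ v, 0 < x v := pos_of_rho_mul_le
    (connected_inducedJoin hL (mem_exceptionalFinset.1 hr).1) hx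
    (fun h0 => by simp [h0] at hxx) (by rw [hxx, mul_one]; exact hcon.trans hge)
  have := (mul_pos (mul_pos (sum_pos (fun l _ => hxpos l) hL) (sum_pos (fun r _ => hxpos r) hR))
    (sub_pos.2 hcard)).trans_le hgain
  linarith [pos_of_mul_pos_right this (sq_nonneg _)]

theorem mul_sqrt_le_of_le_mul {K R n : ℝ} (hK : 1 ≤ K) (hn : 0 ≤ n)
    (hR : R ≤ 1 / (8 * K ^ 2) ^ 2 * n) :
    2 * (K * √R) ≤ √n / 4 ∧ 2 * (K * √R) * (K * √n) ≤ n / 4 := by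
  have hsqrt : K ^ 2 * √R ≤ √n / 8 := by
    have := Real.sqrt_le_sqrt hR
    rw [Real.sqrt_mul (by positivity), ← _root_.one_div_pow, Real.sqrt_sq (by positivity)] at this
    calc K ^ 2 * √R ≤ K ^ 2 * (1 / (8 * K ^ 2) * √n) := by gcongr
      _ = √n / 8 := by field_simp
  constructor
  · nlinarith [mul_le_mul_of_nonneg_right (le_self_pow₀ hK two_ne_zero) (Real.sqrt_nonneg R)]
  · nlinarith [mul_le_mul_of_nonneg_right hsqrt (Real.sqrt_nonneg n), Real.mul_self_sqrt hn]

theorem HasBoundedOrientation.eq_inducedJoin [Nonempty α] {C : ℕ}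
    (h : HasBoundedOrientation G C) (hL : L.Nonempty)
    (hW : ∀ w ∈ commonNeighborFinset G L, ∀ v, G.Adj w v → v ∈ L)
    (hcard : (1 - 1 / (8 * ((C : ℝ) + 1) ^ 2) ^ 2) * Fintype.card α ≤
      #(commonNeighborFinset G L))
    (hrho : Fintype.card α / 16 ≤ rho G ^ 2) (hmax : rho (inducedJoin G L) ≤ rho G) :
    G = inducedJoin G L := by
  rcases (exceptionalFinset G L).eq_empty_or_nonempty with hR | hR
  · exact eq_inducedJoin_of_exceptionalFinset_eq_empty hR hW
  have hn : (0 : ℝ) < Fintype.card α := by exact_mod_cast Fintype.card_pos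
  have hRn : (#(exceptionalFinset G L) : ℝ) ≤
      1 / (8 * ((C : ℝ) + 1) ^ 2) ^ 2 * Fintype.card α := by
    have := card_add_card_add_card_exceptionalFinset G L
    rw [← @Nat.cast_inj ℝ] at this
    push_cast at this
    linarith [(#L).cast_nonneg (α := ℝ)]
  obtain ⟨hκ, hκ'⟩ := mul_sqrt_le_of_le_mul (by simp) hn.le hRn
  have hge : √(Fintype.card α) / 4 ≤ rho G := by
    refine (abs_le_of_sq_le_sq' ?_ (rho_nonneg G)).2
    rw [div_pow, Real.sq_sqrt hn.le]
    linarith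
  refine absurd hmax (not_le.2 (h.rho_lt_rho_inducedJoin hL hW hR (hκ.trans hge) ?_))
  have hε : 1 / (8 * ((C : ℝ) + 1) ^ 2) ^ 2 ≤ 1 / 64 :=
    one_div_le_one_div_of_le (by norm_num) (by nlinarith [sq_nonneg ((C : ℝ) ^ 2)])
  calc _ ≤ (Fintype.card α : ℝ) / 4 :=
        (mul_le_mul_of_nonneg_left h.rho_le (by positivity)).trans hκ'
    _ < (1 - 1 / (8 * ((C : ℝ) + 1) ^ 2) ^ 2) * Fintype.card α := by nlinarith
    _ ≤ _ := hcard

theorem eventually_eq_inducedJoin [Finite V] {A B : Finset V} {q : ℕ} (hF : F.IsTree)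
    (hbip : F.IsBipartiteWith (A : Set V) (B : Set V)) (hA : #A = q + 1) (hq : 0 < q) {a b : V}
    (ha : a ∈ A) (hab : F.Adj a b) (hleaf : ∀ v, F.Adj a v → v = b) :
    ∀ᶠ n : ℕ in atTop, ∀ G ∈ SPEX n F, q * (n - q) ≤ rho G ^ 2 →
      ∃ L : Finset (Fin n), #L = q ∧ G = inducedJoin G L := by
  have := Fintype.ofFinite V
  set C := Fintype.card V
  let ε : ℝ := 1 / (8 * (C + 1) ^ 2) ^ 2
  have hε : ε ≤ 1 / 2 := one_div_le_one_div_of_le (by norm_num) (by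
    nlinarith [sq_nonneg ((C : ℝ) ^ 2), C.cast_nonneg (α := ℝ)])
  filter_upwards [eventually_exists_card_commonNeighborFinset hq C (by positivity : 0 < ε),
    eventually_gt_atTop (2 * q), eventually_le_mul_natCast one_half_pos C] with n hn hqn hCn
    G hG hrho
  have : Nonempty (Fin n) := ⟨⟨0, by lia⟩⟩
  have hqn' : (2 * q : ℝ) < n := by exact_mod_cast hqn
  have hor := hasBoundedOrientation_of_free hF hG.1
  obtain ⟨L, hL, hLW⟩ := hn G hor (fun T hT =>
    card_commonNeighborFinset_le hbip hG.1 (hT.trans hA.symm)) hrho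
  have hCW : C ≤ #(commonNeighborFinset G L) := by
    exact_mod_cast hCn.trans ((mul_le_mul_of_nonneg_right (by linarith) n.cast_nonneg).trans hLW)
  refine ⟨L, hL, hor.eq_inducedJoin (card_pos.1 (hL ▸ hq)) (fun w hw v hwv => ?_)
    (by rwa [Fintype.card_fin]) ?_ (hG.2 _ (free_inducedJoin hG.1 hCW))⟩
  · by_contra hv
    exact hG.1 (isContained_of_leaf hbip ha hab hleaf (by lia)
      (fun l hl w hw => mem_commonNeighborFinset.1 hw l hl) hCW hw hv hwv)
  · have : (1 : ℝ) ≤ q := by exact_mod_cast hq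
    rw [Fintype.card_fin]
    nlinarith

end InducedJoin

section Join

variable {V W : Type*} {G G' : SimpleGraph V} {H H' : SimpleGraph W}

@[simp] theorem join_adj_inl_inl {u v : V} :
    (join G H).Adj (Sum.inl u) (Sum.inl v) ↔ G.Adj u v := by simp [join]

@[simp] theorem join_adj_inr_inr {u v : W} :
    (join G H).Adj (Sum.inr u) (Sum.inr v) ↔ H.Adj u v := by simp [join]

@[simp] theorem join_adj_inl_inr {u : V} {v : W} :
    (join G H).Adj (Sum.inl u) (Sum.inr v) := by simp [join]

@[simp] theorem join_adj_inr_inl {u : V} {v : W} :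
    (join G H).Adj (Sum.inr v) (Sum.inl u) := by simp [join]

theorem join_mono (hG : G ≤ G') (hH : H ≤ H') : join G H ≤ join G' H' := by
  rintro (u | u) (v | v) h
  · exact join_adj_inl_inl.2 (hG (join_adj_inl_inl.1 h))
  · exact join_adj_inl_inr
  · exact join_adj_inr_inl
  · exact join_adj_inr_inr.2 (hH (join_adj_inr_inr.1 h))

theorem join_bot_bot : join (⊥ : SimpleGraph V) (⊥ : SimpleGraph W) =
    completeBipartiteGraph V W := by
  ext (u | u) (v | v) <;> simp

theorem join_connected [Nonempty V] [Nonempty W] (G : SimpleGraph V) (H : SimpleGraph W) :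
    (join G H).Connected := by
  obtain ⟨i⟩ := ‹Nonempty V›
  obtain ⟨j⟩ := ‹Nonempty W›
  refine (connected_iff_exists_forall_reachable _).2 ⟨Sum.inl i, ?_⟩
  rintro (u | u)
  · exact (join_adj_inl_inr (v := j)).reachable.trans join_adj_inr_inl.reachable
  · exact join_adj_inl_inr.reachable

theorem join_strictMono_left (H : SimpleGraph W) : StrictMono fun G : SimpleGraph V => join G H :=
  Monotone.strictMono_of_injective (fun _ _ h => join_mono h le_rfl) fun G G' h => by
    ext u v
    rw [← join_adj_inl_inl (H := H), show join G H = join G' H from h, join_adj_inl_inl]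

theorem join_strictMono_right (G : SimpleGraph V) : StrictMono fun H : SimpleGraph W => join G H :=
  Monotone.strictMono_of_injective (fun _ _ h => join_mono le_rfl h) fun H H' h => by
    ext u v
    rw [← join_adj_inr_inr (G := G), show join G H = join G H' from h, join_adj_inr_inr]

theorem exists_iso_join_of_inducedJoin [Fintype V] (G : SimpleGraph V) {L : Finset V} {q n : ℕ}
    (hL : #L = q) (hn : Fintype.card V = n) : ∃ Q : SimpleGraph (Fin q),
      Nonempty (inducedJoin G L ≃g join Q (⊥ : SimpleGraph (Fin (n - q)))) := by
  have e₁ : {v // v ∈ L} ≃ Fin q := Fintype.equivFinOfCardEq (by simp [hL])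
  have e₂ : {v // v ∉ L} ≃ Fin (n - q) := Fintype.equivFinOfCardEq (by
    rw [Fintype.card_subtype_compl, hn, Fintype.card_coe, hL])
  refine ⟨G.comap fun i => (e₁.symm i : V), ⟨RelIso.symm
    ⟨(Equiv.sumCongr e₁.symm e₂.symm).trans (Equiv.sumCompl (· ∈ L)), ?_⟩⟩⟩
  rintro (i | i) (j | j) <;>
    simp [inducedJoin, (e₁.symm _).2, (e₂.symm _).2]

end Join

section JoinSpectrum

variable {V W : Type*} [Fintype V] [Fintype W] {G G' : SimpleGraph V} {x : V ⊕ W → ℝ}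

theorem mulVec_join_bot_inl (G : SimpleGraph V) (x : V ⊕ W → ℝ) (v : V) :
    ((join G (⊥ : SimpleGraph W)).adjMatrix ℝ *ᵥ x) (Sum.inl v) =
      (G.adjMatrix ℝ *ᵥ (x ∘ Sum.inl)) v + ∑ w, x (Sum.inr w) := by
  simp [mulVec, dotProduct, Fintype.sum_sum_type, adjMatrix_apply]

theorem mulVec_join_bot_inr (G : SimpleGraph V) (x : V ⊕ W → ℝ) (w : W) :
    ((join G (⊥ : SimpleGraph W)).adjMatrix ℝ *ᵥ x) (Sum.inr w) = ∑ v, x (Sum.inl v) := by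
  simp [mulVec, dotProduct, Fintype.sum_sum_type, adjMatrix_apply]

theorem dotProduct_mulVec_join_bot (G : SimpleGraph V) (x : V ⊕ W → ℝ) :
    x ⬝ᵥ ((join G (⊥ : SimpleGraph W)).adjMatrix ℝ *ᵥ x) =
      (x ∘ Sum.inl) ⬝ᵥ (G.adjMatrix ℝ *ᵥ (x ∘ Sum.inl)) +
        2 * ((∑ v, x (Sum.inl v)) * ∑ w, x (Sum.inr w)) := by
  simp only [dotProduct, Fintype.sum_sum_type, mulVec_join_bot_inl, mulVec_join_bot_inr,
    mul_add, sum_add_distrib, ← sum_mul, Function.comp_apply]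
  ring

theorem sqrt_card_mul_card_le_rho_join_bot [Nonempty V] [Nonempty W] (G : SimpleGraph V) :
    √(Fintype.card V * Fintype.card W) ≤ rho (join G (⊥ : SimpleGraph W)) := by
  let x : V ⊕ W → ℝ := Sum.elim (fun _ => √(Fintype.card W)) fun _ => √(Fintype.card V)
  have hV : (0 : ℝ) < Fintype.card V := by exact_mod_cast Fintype.card_pos
  have hx : 0 ≤ x := by rintro (_ | _) <;> simp [x]
  have hxx : x ⬝ᵥ x = 2 * (Fintype.card V * Fintype.card W) := by
    simp [x, dotProduct, Fintype.sum_sum_type]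
    ring
  have hnonneg : 0 ≤ (x ∘ Sum.inl) ⬝ᵥ (G.adjMatrix ℝ *ᵥ (x ∘ Sum.inl)) :=
    dotProduct_nonneg_of_nonneg (fun v => hx (Sum.inl v))
      (mulVec_apply_nonneg G fun v => hx (Sum.inl v))
  have hle := dotProduct_mulVec_le_rho_mul (join G (⊥ : SimpleGraph W)) x
  have hquad : 2 * ((∑ v, x (Sum.inl v)) * ∑ w, x (Sum.inr w)) =
      √(Fintype.card V * Fintype.card W) * (2 * (Fintype.card V * Fintype.card W)) := by
    simp only [x, Sum.elim_inl, Sum.elim_inr, sum_const, card_univ, nsmul_eq_mul,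
      Real.sqrt_mul hV.le]
    ring
  rw [dotProduct_mulVec_join_bot, hxx, hquad] at hle
  exact le_of_mul_le_mul_right (le_of_add_le_of_nonneg_right hle hnonneg) (by positivity)

theorem sum_degree_mul_eq (G : SimpleGraph V) (c : ℝ) :
    ∑ v, ∑ _w ∈ G.neighborFinset v, c = 2 * #G.edgeFinset * c := by
  simp only [sum_const, nsmul_eq_mul, ← sum_mul, card_neighborFinset_eq_degree]
  exact_mod_cast congrArg (fun k : ℕ => (k : ℝ) * c) G.sum_degrees_eq_twice_card_edges

theorem dotProduct_mulVec_eq_sum (G : SimpleGraph V) (y : V → ℝ) :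
    y ⬝ᵥ (G.adjMatrix ℝ *ᵥ y) = ∑ v, ∑ w ∈ G.neighborFinset v, y v * y w := by
  simp only [dotProduct, adjMatrix_mulVec_apply, mul_sum]

theorem two_mul_card_edgeFinset_mul_sq_le {y : V → ℝ} {a : ℝ} (ha : 0 ≤ a) (h : ∀ v, a ≤ y v) :
    2 * #G.edgeFinset * a ^ 2 ≤ y ⬝ᵥ (G.adjMatrix ℝ *ᵥ y) := by
  rw [dotProduct_mulVec_eq_sum, ← sum_degree_mul_eq, sq]
  gcongr with v _ w _
  exacts [ha.trans (h v), h v, h w]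

theorem le_two_mul_card_edgeFinset_mul_sq {y : V → ℝ} {b : ℝ} (hy : 0 ≤ y) (h : ∀ v, y v ≤ b) :
    y ⬝ᵥ (G.adjMatrix ℝ *ᵥ y) ≤ 2 * #G.edgeFinset * b ^ 2 := by
  rw [dotProduct_mulVec_eq_sum, ← sum_degree_mul_eq, sq]
  gcongr with v _ w _
  exacts [hy w, (hy v).trans (h v), h v, h w]

theorem join_bot_eigenvector_bounds {c : ℝ} (hx : 0 ≤ x) (hx0 : x ≠ 0)
    (heig : (join G (⊥ : SimpleGraph W)).adjMatrix ℝ *ᵥ x = c • x) (hc : Fintype.card V < c) :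
    0 < ∑ w, x (Sum.inr w) ∧ ∀ v, (∑ w, x (Sum.inr w)) / c ≤ x (Sum.inl v) ∧
      x (Sum.inl v) ≤ (∑ w, x (Sum.inr w)) / (c - Fintype.card V) := by
  have hc0 : 0 < c := (Nat.cast_nonneg _).trans_lt hc
  set y := x ∘ Sum.inl
  have hy : 0 ≤ y := fun v => hx (Sum.inl v)
  set s := ∑ v, y v
  set t := ∑ w, x (Sum.inr w)
  have hinl : ∀ v, c * y v = (G.adjMatrix ℝ *ᵥ y) v + t := fun v => by
    rw [← mulVec_join_bot_inl, heig]
    rfl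
  have hinr : ∀ w, c * x (Sum.inr w) = s := fun w => by
    rw [← smul_eq_mul, ← Pi.smul_apply, ← heig, mulVec_join_bot_inr]
    rfl
  have hGs : ∀ v, (G.adjMatrix ℝ *ᵥ y) v ≤ s := fun v => by
    rw [adjMatrix_mulVec_apply]
    exact sum_le_univ_sum_of_nonneg hy
  have hs : (c - Fintype.card V) * s ≤ Fintype.card V * t := by
    have : ∑ v, c * y v ≤ ∑ _v : V, (s + t) := sum_le_sum fun v _ => by linarith [hinl v, hGs v]
    rw [← mul_sum, sum_const, card_univ, nsmul_eq_mul] at this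
    linarith
  have ht : 0 ≤ t := sum_nonneg fun w _ => hx (Sum.inr w)
  refine ⟨ht.lt_of_ne' fun h0 => hx0 ?_, fun v => ⟨?_, ?_⟩⟩
  · have hs0 : s = 0 := le_antisymm
      (nonpos_of_mul_nonpos_right (hs.trans_eq (by rw [h0, mul_zero])) (sub_pos.2 hc))
      (sum_nonneg fun v _ => hy v)
    ext (v | w)
    · exact (sum_eq_zero_iff_of_nonneg fun v _ => hy v).1 hs0 v (mem_univ v)
    · exact (mul_eq_zero.1 ((hinr w).trans hs0)).resolve_left hc0.ne'
  · rw [div_le_iff₀' hc0]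
    exact (le_add_of_nonneg_left (mulVec_apply_nonneg G hy v)).trans_eq (hinl v).symm
  · rw [le_div_iff₀' (sub_pos.2 hc)]
    refine le_of_mul_le_mul_left ?_ hc0
    calc c * ((c - Fintype.card V) * y v) = (c - Fintype.card V) * (c * y v) := by ring
      _ ≤ (c - Fintype.card V) * (s + t) :=
        mul_le_mul_of_nonneg_left (by linarith [hinl v, hGs v]) (sub_pos.2 hc).le
      _ ≤ c * t := by linarith

theorem mul_sq_lt_mul_sq_sub {e e' q c : ℝ} (he : 0 ≤ e) (he' : e + 1 ≤ e') (hq : 0 < q)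
    (hc : 2 * q * (e + 1) ≤ c) : e * c ^ 2 < e' * (c - q) ^ 2 :=
  calc e * c ^ 2 ≤ (e + 1) * (c ^ 2 - 2 * q * c) := by
        nlinarith [mul_pos hq (by linarith : 0 < e + 1)]
    _ < (e + 1) * (c - q) ^ 2 := by nlinarith [mul_pos hq hq]
    _ ≤ e' * (c - q) ^ 2 := mul_le_mul_of_nonneg_right he' (sq_nonneg _)

-- The Perron vector of `join G ⊥` is nearly constant on `V`, so the number of edges inside `V`
-- decides the comparison.
theorem rho_join_bot_lt_of_card_edgeFinset_lt [Nonempty V] [Nonempty W]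
    (hW : 2 * Fintype.card V * (#G.edgeFinset + 1) ≤ √(Fintype.card V * Fintype.card W))
    (h : #G.edgeFinset < #G'.edgeFinset) :
    rho (join G (⊥ : SimpleGraph W)) < rho (join G' (⊥ : SimpleGraph W)) := by
  obtain ⟨x, hx, hxx, heig⟩ := exists_nonneg_eigenvector (join G (⊥ : SimpleGraph W))
  set c := rho (join G (⊥ : SimpleGraph W))
  have hq : (0 : ℝ) < Fintype.card V := by exact_mod_cast Fintype.card_pos
  have hc : 2 * Fintype.card V * (#G.edgeFinset + 1 : ℝ) ≤ c :=
    hW.trans (sqrt_card_mul_card_le_rho_join_bot G)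
  have hqc : Fintype.card V < c := by nlinarith [(#G.edgeFinset).cast_nonneg (α := ℝ)]
  obtain ⟨ht, hbounds⟩ := join_bot_eigenvector_bounds hx (fun h0 => by simp [h0] at hxx) heig hqc
  set t := ∑ w, x (Sum.inr w)
  have hinner : (x ∘ Sum.inl) ⬝ᵥ (G.adjMatrix ℝ *ᵥ (x ∘ Sum.inl)) <
      (x ∘ Sum.inl) ⬝ᵥ (G'.adjMatrix ℝ *ᵥ (x ∘ Sum.inl)) :=
    calc _ ≤ 2 * #G.edgeFinset * (t / (c - Fintype.card V)) ^ 2 :=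
          le_two_mul_card_edgeFinset_mul_sq (fun v => hx (Sum.inl v)) fun v => (hbounds v).2
      _ < 2 * #G'.edgeFinset * (t / c) ^ 2 := by
          have hsq := mul_sq_lt_mul_sq_sub (#G.edgeFinset).cast_nonneg
            (by exact_mod_cast h : (#G.edgeFinset : ℝ) + 1 ≤ #G'.edgeFinset) hq hc
          rw [div_pow, div_pow, mul_div_assoc', mul_div_assoc', div_lt_div_iff₀
            (pow_pos (sub_pos.2 hqc) 2) (pow_pos (hq.trans hqc) 2)]
          nlinarith [mul_lt_mul_of_pos_left hsq (pow_pos ht 2)]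
      _ ≤ _ := two_mul_card_edgeFinset_mul_sq_le (div_nonneg ht.le (hq.trans hqc).le)
          fun v => (hbounds v).1
  calc c = x ⬝ᵥ ((join G (⊥ : SimpleGraph W)).adjMatrix ℝ *ᵥ x) :=
        (dotProduct_mulVec_of_mulVec_eq_smul hxx heig).symm
    _ < x ⬝ᵥ ((join G' (⊥ : SimpleGraph W)).adjMatrix ℝ *ᵥ x) := by
        rw [dotProduct_mulVec_join_bot, dotProduct_mulVec_join_bot]
        gcongr
    _ ≤ _ := by simpa [hxx] using dotProduct_mulVec_le_rho_mul (join G' (⊥ : SimpleGraph W)) x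

theorem eventually_rho_join_bot_lt {q : ℕ} (hq : 0 < q) :
    ∀ᶠ m : ℕ in atTop, ∀ Q Q' : SimpleGraph (Fin q), #Q.edgeFinset < #Q'.edgeFinset →
      rho (join Q (⊥ : SimpleGraph (Fin m))) < rho (join Q' (⊥ : SimpleGraph (Fin m))) := by
  have : Nonempty (Fin q) := ⟨⟨0, hq⟩⟩
  have htendsto : Tendsto (fun m : ℕ => √(q * m)) atTop atTop :=
    Real.tendsto_sqrt_atTop.comp
      (tendsto_natCast_atTop_atTop.const_mul_atTop (by exact_mod_cast hq))
  filter_upwards [eventually_gt_atTop 0, eventually_all.2 fun Q : SimpleGraph (Fin q) =>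
    htendsto.eventually_ge_atTop (2 * q * (#Q.edgeFinset + 1))] with m hm hlarge Q Q' hQ
  have : Nonempty (Fin m) := ⟨⟨0, hm⟩⟩
  exact rho_join_bot_lt_of_card_edgeFinset_lt (by simpa using hlarge Q) hQ

end JoinSpectrum

section Forest

variable {V : Type*} {F : SimpleGraph V} {A B : Finset V}

theorem sum_card_adj_add_two_le_of_isAcyclic (hF : F.IsAcyclic) {Z : Finset V}
    (hZ : Z.Nonempty) : ∑ v ∈ Z, #{w ∈ Z | F.Adj v w} + 2 ≤ 2 * #Z := by
  have : Nonempty Z := hZ.to_subtype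
  obtain ⟨T, hFT, -, hT⟩ := (connected_top (V := Z)).exists_isTree_le_of_le_of_isAcyclic
    (H := F.comap ((↑) : Z → V)) le_top (hF.comap ⟨(↑), id⟩ Subtype.val_injective)
  have hle : ∑ v ∈ Z, #{w ∈ Z | F.Adj v w} ≤ ∑ v : Z, T.degree v := by
    rw [← sum_coe_sort Z]
    refine sum_le_sum fun v _ => ?_
    rw [← card_neighborFinset_eq_degree, ← card_map (Function.Embedding.subtype _)]
    refine card_le_card fun w hw => ?_
    obtain ⟨hwZ, hvw⟩ := mem_filter.1 hw
    exact mem_map.2 ⟨⟨w, hwZ⟩, (mem_neighborFinset _ _ _).2 (hFT hvw), rfl⟩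
  have hcard := hT.card_edgeFinset
  rw [Fintype.card_coe] at hcard
  have := T.sum_degrees_eq_twice_card_edges
  lia

theorem sum_card_adj_lt_of_isAcyclic (hF : F.IsAcyclic) {X Y : Finset V} (hX : X.Nonempty)
    (hXY : Disjoint X Y) : ∑ a ∈ X, #{b ∈ Y | F.Adj a b} < #X + #Y := by
  have hle := sum_card_adj_add_two_le_of_isAcyclic hF (hX.mono (subset_union_left (s₂ := Y)))
  rw [sum_union hXY, card_union_of_disjoint hXY] at hle
  have hXle : ∑ a ∈ X, #{b ∈ Y | F.Adj a b} ≤ ∑ a ∈ X, #{w ∈ X ∪ Y | F.Adj a w} :=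
    sum_le_sum fun a _ => card_le_card (filter_subset_filter _ subset_union_right)
  have hYle : ∑ b ∈ Y, #{a ∈ X | F.Adj a b} ≤ ∑ b ∈ Y, #{w ∈ X ∪ Y | F.Adj b w} := by
    refine sum_le_sum fun b _ => ?_
    simp only [F.adj_comm _ b]
    exact card_le_card (filter_subset_filter _ subset_union_left)
  have hdouble : ∑ a ∈ X, #{b ∈ Y | F.Adj a b} = ∑ b ∈ Y, #{a ∈ X | F.Adj a b} :=
    sum_card_bipartiteAbove_eq_sum_card_bipartiteBelow _
  lia

theorem two_le_sum_card_adj_compl [Fintype V] (hF : F.IsAcyclic)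
    (hbip : F.IsBipartiteWith (A : Set V) (B : Set V)) (hdeg : ∀ a ∈ A, 2 ≤ F.degree a)
    {S : Finset V} (hS : #S < #A) : 2 ≤ ∑ a ∈ A \ S, #{b ∈ Sᶜ | F.Adj a b} := by
  have hXY : Disjoint (A \ S) (S \ A) := disjoint_sdiff_sdiff
  have hcard : #(S \ A) + 1 ≤ #(A \ S) := by
    have := card_sdiff_add_card_inter A S
    have := card_sdiff_add_card_inter S A
    rw [inter_comm] at this
    lia
  have hlt := sum_card_adj_lt_of_isAcyclic hF (card_pos.1 (by lia)) hXY
  have hdeg' : ∀ a ∈ A \ S, 2 ≤ #{b ∈ S \ A | F.Adj a b} + #{b ∈ Sᶜ | F.Adj a b} := by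
    intro a ha
    have haA := (Finset.mem_sdiff.1 ha).1
    refine (hdeg a haA).trans ((card_le_card fun v hv => ?_).trans (card_union_le _ _))
    rw [mem_neighborFinset] at hv
    have hvA : v ∉ A := fun h =>
      Set.disjoint_left.1 hbip.disjoint h (hbip.mem_of_mem_adj haA hv)
    by_cases hvS : v ∈ S <;> simp [hvS, hvA, hv]
  have := sum_le_sum hdeg'
  rw [sum_const, smul_eq_mul, sum_add_distrib] at this
  lia

theorem eq_or_eq_compl_of_connected (hF : F.Connected) {S T : Set V}
    (hS : ∀ u v, F.Adj u v → (u ∈ S ↔ v ∉ S)) (hT : ∀ u v, F.Adj u v → (u ∈ T ↔ v ∉ T)) :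
    S = T ∨ S = Tᶜ := by
  obtain ⟨v₀⟩ := hF.nonempty
  have hconst : ∀ u v, F.Reachable u v → ((u ∈ S ↔ u ∈ T) ↔ (v ∈ S ↔ v ∈ T)) := by
    rintro u v ⟨p⟩
    induction p with
    | nil => rfl
    | cons h p ih =>
      rw [← ih]
      have := hS _ _ h
      have := hT _ _ h
      tauto
  by_cases h₀ : v₀ ∈ S ↔ v₀ ∈ T
  · exact Or.inl (Set.ext fun v => (hconst v₀ v (hF.preconnected v₀ v)).1 h₀)
  · refine Or.inr (Set.ext fun v => ?_)
    have := (hconst v₀ v (hF.preconnected v₀ v)).not.1 h₀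
    rw [Set.mem_compl_iff]
    tauto

end Forest

section JoinFree

variable {V U W : Type*} {F : SimpleGraph V} {A B : Finset V}

theorem card_filter_isLeft_le [Fintype V] [Fintype U] {f : V → U ⊕ W}
    (hf : Function.Injective f) : #{v | (f v).isLeft} ≤ Fintype.card U := by
  rw [← card_image_of_injective _ hf, ← card_univ (α := U),
    ← card_map (Function.Embedding.inl (β := W)) (s := univ)]
  refine card_le_card fun s hs => ?_
  obtain ⟨v, hv, rfl⟩ := mem_image.1 hs
  obtain ⟨u, hu⟩ := Sum.isLeft_iff.1 (mem_filter.1 hv).2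
  simp [hu]

theorem free_join_bot_iff (e : V ↪ W) (Q : SimpleGraph U) :
    F.Free (join Q (⊥ : SimpleGraph W)) ↔
      ∀ S : Set V, F.IsVertexCover S → (F.induce S).Free Q := by
  constructor
  · rintro hfree S hS ⟨g⟩
    let f : V → U ⊕ W := fun v => if h : v ∈ S then Sum.inl (g ⟨v, h⟩) else Sum.inr (e v)
    refine hfree ⟨⟨⟨f, fun {u v} huv => ?_⟩, fun u v huv => ?_⟩⟩
    · by_cases hu : u ∈ S <;> by_cases hv : v ∈ S <;> simp only [f, hu, hv, dite_true, dite_false]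
      · exact join_adj_inl_inl.2 (g.toHom.map_adj huv)
      · exact join_adj_inl_inr
      · exact join_adj_inr_inl
      · exact ((hS huv).elim hu hv).elim
    · replace huv : f u = f v := huv
      by_cases hu : u ∈ S <;> by_cases hv : v ∈ S <;>
        simp only [f, hu, hv, dite_true, dite_false, Sum.inl.injEq, Sum.inr.injEq,
          reduceCtorEq] at huv
      · exact congrArg Subtype.val (g.injective huv)
      · exact e.injective huv
  · rintro h ⟨f⟩
    have hadj : ∀ u v, F.Adj u v → (join Q (⊥ : SimpleGraph W)).Adj (f u) (f v) :=
      fun u v huv => f.toHom.map_adj huv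
    have hleft : ∀ v : {v | (f v).isLeft}, ∃ u, f v = Sum.inl u := fun v => Sum.isLeft_iff.1 v.2
    choose g hg using hleft
    refine h {v | (f v).isLeft} (fun u v huv => ?_)
      ⟨⟨⟨g, fun {u v} huv => ?_⟩, fun u v huv => ?_⟩⟩
    · have := hadj u v huv
      rcases hu : f u with i | i <;> rcases hv : f v with j | j <;> simp_all
    · exact join_adj_inl_inl.1 (hg u ▸ hg v ▸ hadj u v huv)
    · exact Subtype.ext (f.injective ((hg u).trans ((congrArg _ huv).trans (hg v).symm)))

theorem free_completeBipartiteGraph [Finite V] [Fintype U] (hF : F.Connected)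
    (hbip : F.IsBipartiteWith (A : Set V) (B : Set V)) (hA : Fintype.card U < #A)
    (hB : Fintype.card U < #B) : F.Free (completeBipartiteGraph U W) := by
  have := Fintype.ofFinite V
  rintro ⟨f⟩
  have hcard := card_filter_isLeft_le (f := f) f.injective
  have hS : ∀ u v, F.Adj u v → (u ∈ {v | (f v).isLeft} ↔ v ∉ {v | (f v).isLeft}) := by
    intro u v huv
    have hadj : (completeBipartiteGraph U W).Adj (f u) (f v) := f.toHom.map_adj huv
    rcases hu : f u with i | i <;> rcases hv : f v with j | j <;> simp_all
  have hT : ∀ u v, F.Adj u v → (u ∈ (A : Set V) ↔ v ∉ (A : Set V)) := fun u v huv => by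
    have := hbip.mem_of_adj huv
    have hu : u ∈ (A : Set V) → u ∉ (B : Set V) := fun h => Set.disjoint_left.1 hbip.disjoint h
    have hv : v ∈ (A : Set V) → v ∉ (B : Set V) := fun h => Set.disjoint_left.1 hbip.disjoint h
    tauto
  rcases eq_or_eq_compl_of_connected hF hS hT with h | h
  · refine absurd (card_le_card fun v hv => mem_filter.2 ⟨mem_univ v, ?_⟩)
      (not_le.2 (hcard.trans_lt hA))
    exact h.ge hv
  · refine absurd (card_le_card fun v hv => mem_filter.2 ⟨mem_univ v, ?_⟩)
      (not_le.2 (hcard.trans_lt hB))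
    exact h.ge (Set.disjoint_right.1 hbip.disjoint hv)

/- A copy of `F` would have at most one edge avoiding the preimage `S` of the clique, whereas
`#S < #A` forces two such edges. -/
theorem free_join_top_edge [Fintype V] [Fintype U] (hF : F.IsAcyclic)
    (hbip : F.IsBipartiteWith (A : Set V) (B : Set V)) (hA : Fintype.card U < #A)
    (hdeg : ∀ a ∈ A, 2 ≤ F.degree a) (i j : W) :
    F.Free (join (⊤ : SimpleGraph U) (edge i j)) := by
  rintro ⟨f⟩
  let S : Finset V := {v | (f v).isLeft}
  have hout : ∀ u v, F.Adj u v → u ∉ S → v ∉ S → s(f u, f v) = s(Sum.inr i, Sum.inr j) := by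
    intro u v huv hu hv
    have hadj : (join (⊤ : SimpleGraph U) (edge i j)).Adj (f u) (f v) := f.toHom.map_adj huv
    rcases hu' : f u with k | k <;> rcases hv' : f v with l | l <;>
      simp_all [S, edge_adj]
  have hone : ∑ a ∈ A \ S, #{b ∈ Sᶜ | F.Adj a b} ≤ 1 := by
    rw [← card_sigma, card_le_one]
    rintro ⟨a, b⟩ hab ⟨a', b'⟩ hab'
    simp only [mem_sigma, mem_filter, mem_compl, Finset.mem_sdiff] at hab hab'
    obtain ⟨⟨haA, haS⟩, hbS, hab⟩ := hab
    obtain ⟨⟨haA', haS'⟩, hbS', hab'⟩ := hab'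
    have heq := (hout a b hab haS hbS).trans (hout a' b' hab' haS' hbS').symm
    rcases Sym2.eq_iff.1 heq with ⟨ha, hb⟩ | ⟨-, hb⟩
    · rw [f.injective ha, f.injective hb]
    · exact (Set.disjoint_right.1 hbip.disjoint (hbip.mem_of_mem_adj haA hab)
        (f.injective hb ▸ haA')).elim
  have hS : #S < #A := (card_filter_isLeft_le (f := f) f.injective).trans_lt hA
  exact absurd (two_le_sum_card_adj_compl hF hbip hdeg hS) (by lia)

theorem familyFree_coverFamily_iff {q : ℕ} (Q : SimpleGraph (Fin q)) :
    FamilyFree (coverFamily F q) Q ↔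
      ∀ S : Set V, F.IsVertexCover S → (F.induce S).Free Q := by
  have hcard : ∀ {S : Set V}, F.induce S ⊑ Q → ∃ T : Finset V, S = T ∧ #T ≤ q := by
    rintro S ⟨g⟩
    have : Finite S := Finite.of_injective g g.injective
    have : Fintype S := Fintype.ofFinite S
    exact ⟨S.toFinset, (Set.coe_toFinset S).symm, by
      simpa using Fintype.card_le_of_injective g g.injective⟩
  unfold coverFamily FamilyFree
  split_ifs with hβ
  · constructor
    · rintro - S hS hSQ
      obtain ⟨T, rfl, hT⟩ := hcard hSQ
      have := hS.vertexCoverNum_le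
      rw [hβ, Set.encard_coe_eq_coe_finsetCard, Nat.cast_le] at this
      lia
    · rintro - ⟨k, H⟩ ⟨e⟩ ⟨f⟩
      have := Fintype.card_le_of_injective _ (f.injective.comp e.symm.injective)
      simp at this
  · constructor
    · rintro h S hS hSQ
      obtain ⟨T, rfl, hT⟩ := hcard hSQ
      have e : (F.induce (T : Set V)).comap T.equivFin.symm ≃g F.induce (T : Set V) :=
        SimpleGraph.Iso.comap T.equivFin.symm _
      exact (free_congr_left e).1 (h ⟨#T, _⟩ ⟨T, hS, hT, ⟨e⟩⟩) hSQ
    · rintro h ⟨k, H⟩ ⟨S, hS, -, ⟨e⟩⟩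
      exact (free_congr_left e).2 (h S hS)

end JoinFree

section Extremal

variable {V W : Type*} {F : SimpleGraph V} {H H' : SimpleGraph W} {n q : ℕ}

theorem SPEX_nonempty [Fintype W] (hH : F.Free H) (hW : Fintype.card W = n) :
    (SPEX n F).Nonempty := by
  obtain ⟨G, hG, hmax⟩ := Set.exists_max_image {G : SimpleGraph (Fin n) | F.Free G} rho
    (Set.toFinite _) ⟨H.overFin hW, (free_congr_right (H.overFinIso hW)).1 hH⟩
  exact ⟨G, hG, hmax⟩

theorem rho_le_of_mem_SPEX [Fintype W] {G : SimpleGraph (Fin n)} (hG : G ∈ SPEX n F) (hH : F.Free H)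
    (hW : Fintype.card W = n) : rho H ≤ rho G := by
  rw [rho_congr (H.overFinIso hW)]
  exact hG.2 _ ((free_congr_right (H.overFinIso hW)).1 hH)

theorem not_lt_of_mem_SPEX [Finite W] {G : SimpleGraph (Fin n)} (hG : G ∈ SPEX n F) (e : G ≃g H)
    (hH' : F.Free H') (hconn : H'.Connected) : ¬ H < H' := fun hlt =>
  have := Fintype.ofFinite W
  (rho_le_of_mem_SPEX hG hH' (by simpa using e.card_eq.symm)).not_gt
    (rho_congr e ▸ rho_lt_of_lt hlt hconn)

theorem SPEX_eq_isoClass (hne : (SPEX n F).Nonempty) (h : ∀ G ∈ SPEX n F, Nonempty (G ≃g H)) :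
    SPEX n F = isoClass n H := by
  refine Set.Subset.antisymm h ?_
  rintro G ⟨e⟩
  obtain ⟨G', hG'⟩ := hne
  obtain ⟨e'⟩ := h G' hG'
  let f := e.trans e'.symm
  exact ⟨(free_congr_right f).2 hG'.1, fun G'' hG'' => rho_congr f ▸ hG'.2 G'' hG''⟩

theorem isoClass_bot : isoClass q (⊥ : SimpleGraph (Fin q)) = {⊥} := by
  ext Q
  refine ⟨fun ⟨e⟩ => ?_, ?_⟩
  · ext u v
    rw [← e.map_adj_iff]
    rfl
  · rintro rfl
    exact ⟨SimpleGraph.Iso.refl⟩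

theorem mem_EX_iff {𝒜 : GraphFamily} {Q : SimpleGraph (Fin q)} :
    Q ∈ EX q 𝒜 ↔ FamilyFree 𝒜 Q ∧
      ∀ Q' : SimpleGraph (Fin q), FamilyFree 𝒜 Q' → #Q'.edgeFinset ≤ #Q.edgeFinset :=
  and_congr_right fun _ => ⟨fun h Q' hQ' => by convert h hQ', fun h Q' _ hQ' => by convert h Q' hQ'⟩

theorem EX_nonempty {𝒜 : GraphFamily} {Q₀ : SimpleGraph (Fin q)} (h : FamilyFree 𝒜 Q₀) :
    (EX q 𝒜).Nonempty := by
  obtain ⟨Q, hQ, hmax⟩ := Set.exists_max_image {Q : SimpleGraph (Fin q) | FamilyFree 𝒜 Q}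
    (fun Q => #Q.edgeFinset) (Set.toFinite _) ⟨Q₀, h⟩
  exact ⟨Q, mem_EX_iff.2 ⟨hQ, hmax⟩⟩

end Extremal

section JoinExtremal

variable {V : Type*} {F : SimpleGraph V} {n q : ℕ}

theorem familyFree_coverFamily_iff_free_join_bot {W : Type*} (e : V ↪ W)
    (Q : SimpleGraph (Fin q)) :
    FamilyFree (coverFamily F q) Q ↔ F.Free (join Q (⊥ : SimpleGraph W)) :=
  (familyFree_coverFamily_iff Q).trans (free_join_bot_iff e Q).symm

theorem mul_sub_le_rho_sq_of_mem_SPEX (hfree : F.Free (join (⊥ : SimpleGraph (Fin q))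
    (⊥ : SimpleGraph (Fin (n - q))))) (hq : 0 < q) (hqn : q < n) {G : SimpleGraph (Fin n)}
    (hG : G ∈ SPEX n F) : (q : ℝ) * (n - q) ≤ rho G ^ 2 := by
  have : Nonempty (Fin q) := ⟨⟨0, hq⟩⟩
  have : Nonempty (Fin (n - q)) := ⟨⟨0, by lia⟩⟩
  have hle := (sqrt_card_mul_card_le_rho_join_bot _).trans
    (rho_le_of_mem_SPEX hG hfree (by simp; lia))
  rw [Real.sqrt_le_iff, Fintype.card_fin, Fintype.card_fin, Nat.cast_sub hqn.le] at hle
  exact hle.2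

theorem SPEX_eq_isoClass_completeBipartiteGraph_iff (e : V ↪ Fin (n - q)) (hq : 0 < q)
    (hqn : q < n)
    (hfree : F.Free (join (⊥ : SimpleGraph (Fin q)) (⊥ : SimpleGraph (Fin (n - q)))))
    (hsub : SPEX n F ⊆ joinFamily n q (coverFamily F q)) :
    SPEX n F = isoClass n (completeBipartiteGraph (Fin q) (Fin (n - q))) ↔
      EX q (coverFamily F q) = isoClass q (⊥ : SimpleGraph (Fin q)) := by
  have : Nonempty (Fin q) := ⟨⟨0, hq⟩⟩
  have : Nonempty (Fin (n - q)) := ⟨⟨0, by lia⟩⟩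
  have hne : (SPEX n F).Nonempty := SPEX_nonempty hfree (by simp; lia)
  rw [isoClass_bot, ← join_bot_bot]
  constructor
  · intro h
    obtain ⟨G, hG⟩ := hne
    obtain ⟨f⟩ : G ∈ isoClass n (join ⊥ ⊥) := h ▸ hG
    refine Set.eq_singleton_iff_nonempty_unique_mem.2
      ⟨EX_nonempty ((familyFree_coverFamily_iff_free_join_bot e ⊥).2 hfree), fun Q hQ => ?_⟩
    by_contra hQ0
    exact not_lt_of_mem_SPEX hG f ((familyFree_coverFamily_iff_free_join_bot e Q).1 hQ.1)
      (join_connected _ _) (join_strictMono_left _ (bot_lt_iff_ne_bot.2 hQ0))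
  · refine fun h => SPEX_eq_isoClass hne fun G hG => ?_
    obtain ⟨Q, hQ, hGQ⟩ := hsub hG
    rw [h] at hQ
    exact hQ ▸ hGQ

theorem SPEX_eq_isoClass_S0_iff (e : V ↪ Fin (n - q)) (hne : (SPEX n F).Nonempty)
    (hsub : SPEX n F ⊆ joinFamily n q (coverFamily F q)) :
    SPEX n F = isoClass n (S0 n q) ↔
      FamilyFree (coverFamily F q) (⊤ : SimpleGraph (Fin q)) := by
  constructor
  · intro h
    obtain ⟨G, hG⟩ := hne
    obtain ⟨f⟩ : G ∈ isoClass n (S0 n q) := h ▸ hG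
    exact (familyFree_coverFamily_iff_free_join_bot e ⊤).2 ((free_congr_right f).1 hG.1)
  · refine fun h => SPEX_eq_isoClass hne fun G hG => ?_
    obtain ⟨Q, hQ, hGQ⟩ := hsub hG
    have hQtop : Q = ⊤ := edgeFinset_inj.1
      (eq_of_subset_of_card_le
      (edgeFinset_mono le_top) (by convert (mem_EX_iff.1 hQ).2 ⊤ h))
    rwa [hQtop] at hGQ

end JoinExtremal

section Characterization

variable {V : Type*} {F : SimpleGraph V} {A B : Finset V} {n q : ℕ}

theorem familyFree_coverFamily_top_iff [Finite V]
    (hbip : F.IsBipartiteWith (A : Set V) (B : Set V))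
    (hA : #A = q + 1) : FamilyFree (coverFamily F q) (⊤ : SimpleGraph (Fin q)) ↔
      F.vertexCoverNum = ((q + 1 : ℕ) : ℕ∞) := by
  have := Fintype.ofFinite V
  rw [familyFree_coverFamily_iff]
  constructor
  · intro h
    refine le_antisymm ?_ ?_
    · have := (isVertexCover_left hbip).vertexCoverNum_le
      rwa [Set.encard_coe_eq_coe_finsetCard, hA] at this
    · obtain ⟨S, hSβ, hS⟩ := vertexCoverNum_exists F
      rw [← hSβ, Set.encard_eq_coe_toFinset_card, Nat.cast_le]
      by_contra! hlt
      obtain ⟨g⟩ : Nonempty (S ↪ Fin q) := Function.Embedding.nonempty_of_card_le (by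
        rw [← Set.toFinset_card, Fintype.card_fin]; lia)
      exact h S hS ⟨⟨⟨g, fun huv => g.injective.ne huv.ne⟩, g.injective⟩⟩
  · rintro hβ S hS ⟨g⟩
    have hle := hS.vertexCoverNum_le
    have hcard := Fintype.card_le_of_injective g g.injective
    rw [hβ, Set.encard_eq_coe_toFinset_card, Nat.cast_le, Set.toFinset_card] at hle
    rw [Fintype.card_fin] at hcard
    lia

theorem free_join_bot_bot [Finite V] (hF : F.IsTree)
    (hbip : F.IsBipartiteWith (A : Set V) (B : Set V)) (hcard : #A ≤ #B) (hA : #A = q + 1)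
    {W : Type*} :
    F.Free (join (⊥ : SimpleGraph (Fin q)) (⊥ : SimpleGraph W)) := by
  rw [join_bot_bot]
  exact free_completeBipartiteGraph hF.connected hbip (by simp [hA]) (by simp; lia)

variable [Fintype V]

theorem minDegreeOn_eq_one_iff [Nontrivial V] (hF : F.Connected) :
    minDegreeOn F A = 1 ↔ ∃ a ∈ A, F.degree a = 1 := by
  constructor
  · intro h
    have hne := Nat.nonempty_of_sInf_eq_succ h
    obtain ⟨a, ha, hdeg⟩ := Nat.sInf_mem hne
    exact ⟨a, ha, hdeg.trans h⟩
  · rintro ⟨a, ha, hdeg⟩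
    refine le_antisymm (Nat.sInf_le ⟨a, ha, hdeg⟩) (le_csInf ⟨_, a, ha, rfl⟩ ?_)
    rintro _ ⟨b, -, rfl⟩
    exact hF.preconnected.degree_pos_of_nontrivial b

theorem minDegreeOn_eq_one_of_iso_join (hF : F.IsTree)
    (hbip : F.IsBipartiteWith (A : Set V) (B : Set V)) (hA : #A = q + 1) (hq : 0 < q)
    (hn : q + 2 ≤ n) {G : SimpleGraph (Fin n)} (hG : G ∈ SPEX n F) {Q : SimpleGraph (Fin q)}
    (e : G ≃g join Q (⊥ : SimpleGraph (Fin (n - q)))) : minDegreeOn F A = 1 := by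
  have : Nonempty (Fin q) := ⟨⟨0, hq⟩⟩
  have : NeZero (n - q) := ⟨by lia⟩
  have : Nontrivial (Fin (n - q)) := Fin.nontrivial_iff_two_le.2 (by lia)
  have : Nontrivial V :=
    Set.nontrivial_of_nontrivial (one_lt_card_iff_nontrivial.1 (show 1 < #A by lia))
  rw [minDegreeOn_eq_one_iff hF.connected]
  by_contra! h
  have hdeg : ∀ a ∈ A, 2 ≤ F.degree a := fun a ha => by
    have := hF.connected.preconnected.degree_pos_of_nontrivial a
    have := h a ha
    lia
  obtain ⟨i, j, hij⟩ := exists_pair_ne (Fin (n - q))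
  have hedge : (⊥ : SimpleGraph (Fin (n - q))) < edge i j :=
    bot_lt_iff_ne_bot.2 fun h0 => by
      have : (edge i j).Adj i j := by simp [edge_adj, hij]
      rwa [h0] at this
  exact not_lt_of_mem_SPEX hG e
    (free_join_top_edge hF.isAcyclic hbip (by simp [hA]) hdeg i j) (join_connected _ _)
    ((join_mono le_top le_rfl).trans_lt (join_strictMono_right ⊤ hedge))

theorem eventually_SPEX_subset_joinFamily (hF : F.IsTree)
    (hbip : F.IsBipartiteWith (A : Set V) (B : Set V)) (hcard : #A ≤ #B) (hA : #A = q + 1)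
    (hq : 0 < q) (hδ : minDegreeOn F A = 1) :
    ∀ᶠ n : ℕ in atTop, SPEX n F ⊆ joinFamily n q (coverFamily F q) := by
  have : Nontrivial V :=
    Set.nontrivial_of_nontrivial (one_lt_card_iff_nontrivial.1 (show 1 < #A by lia))
  obtain ⟨a, ha, hdeg⟩ := (minDegreeOn_eq_one_iff hF.connected).1 hδ
  obtain ⟨b, hab, hleaf⟩ := degree_eq_one_iff_existsUnique_adj.1 hdeg
  filter_upwards [eventually_eq_inducedJoin hF hbip hA hq ha hab hleaf,
    (tendsto_sub_atTop_nat q).eventually (eventually_rho_join_bot_lt hq),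
    eventually_ge_atTop (q + Fintype.card V + 1)] with n hstruct hlt hn G hG
  obtain ⟨L, hL, hGL⟩ := hstruct G hG
    (mul_sub_le_rho_sq_of_mem_SPEX (free_join_bot_bot hF hbip hcard hA) hq (by lia) hG)
  obtain ⟨Q, ⟨e⟩⟩ := exists_iso_join_of_inducedJoin G hL (Fintype.card_fin n)
  rw [← hGL] at e
  obtain ⟨ι⟩ : Nonempty (V ↪ Fin (n - q)) :=
    Function.Embedding.nonempty_of_card_le (by simp; lia)
  refine ⟨Q, mem_EX_iff.2 ⟨(familyFree_coverFamily_iff_free_join_bot ι Q).2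
    ((free_congr_right e).1 hG.1), fun Q' hQ' => ?_⟩, ⟨e⟩⟩
  by_contra! hQQ'
  have hle := rho_le_of_mem_SPEX hG ((familyFree_coverFamily_iff_free_join_bot ι Q').1 hQ')
    (by simp; lia)
  exact hle.not_gt (rho_congr e ▸ hlt Q Q' hQQ')

end Characterization

end SpectralTree

theorem theorem1p5 {V : Type*} [Fintype V] [DecidableEq V] (F : SimpleGraph V) (hF : F.IsTree)
    (A B : Finset V) (hbip : F.IsBipartiteWith (A : Set V) (B : Set V))
    (hunion : A ∪ B = Finset.univ) (hcard : A.card ≤ B.card)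
    (q : ℕ) (hA : A.card = q + 1) (hq : 1 ≤ q) :
    ∃ N : ℕ, ∀ n : ℕ, N ≤ n →
      (SpectralTree.SPEX n F ⊆
          SpectralTree.joinFamily n q (SpectralTree.coverFamily F q) ↔
        SpectralTree.minDegreeOn F A = 1) ∧
      (SpectralTree.SPEX n F =
          SpectralTree.isoClass n (completeBipartiteGraph (Fin q) (Fin (n - q))) ↔
        SpectralTree.minDegreeOn F A = 1 ∧
          SpectralTree.EX q (SpectralTree.coverFamily F q) =
            SpectralTree.isoClass q (⊥ : SimpleGraph (Fin q))) ∧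
      (SpectralTree.SPEX n F = SpectralTree.isoClass n (SpectralTree.S0 n q) ↔
        SpectralTree.minDegreeOn F A = 1 ∧
          F.vertexCoverNum = ((q + 1 : ℕ) : ℕ∞)) := by
  refine Filter.eventually_atTop.1 ?_
  filter_upwards [Filter.eventually_imp_distrib_left.2
      (SpectralTree.eventually_SPEX_subset_joinFamily hF hbip hcard hA hq),
    Filter.eventually_ge_atTop (q + 2 + Fintype.card V)] with n hsub hn
  obtain ⟨ι⟩ : Nonempty (V ↪ Fin (n - q)) :=
    Function.Embedding.nonempty_of_card_le (by simp; lia)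
  have hfree := SpectralTree.free_join_bot_bot hF hbip hcard hA (W := Fin (n - q))
  have hne := SpectralTree.SPEX_nonempty (n := n) hfree (by simp; lia)
  have ⟨G, hG⟩ := hne
  have hδ {Q : SimpleGraph (Fin q)} (e : Nonempty (G ≃g SpectralTree.join Q ⊥)) :
      SpectralTree.minDegreeOn F A = 1 :=
    e.elim (SpectralTree.minDegreeOn_eq_one_of_iso_join hF hbip hA hq (by lia) hG)
  exact ⟨⟨fun h => hδ (h hG).choose_spec.2, hsub⟩,
    (iff_and_self.2 fun h => hδ (Q := ⊥) (SpectralTree.join_bot_bot ▸ h.le hG)).trans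
      (and_congr_right fun h =>
        SpectralTree.SPEX_eq_isoClass_completeBipartiteGraph_iff ι hq (by lia) hfree (hsub h)),
    (iff_and_self.2 fun h => hδ (h.le hG)).trans
      (and_congr_right fun h => (SpectralTree.SPEX_eq_isoClass_S0_iff ι hne (hsub h)).trans
        (SpectralTree.familyFree_coverFamily_top_iff hbip hA))⟩
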